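/- All graphs are finite and simple. A plane graph is outerplane if all its vertices lie on its outer face. For a plane graph $G$ and a face $s$, let $\partial s$ denote the subgraph formed by the edges lying on $s$, and let the periphery of $G$ be the subgraph formed by the edges lying on the outer face. The inner dual of $G$ is the graph whose vertices are the inner (finite) faces of $G$, two distinct inner faces being adjacent when they have a common edge. The resonance graph $R(G)$ is the graph whose vertices are the perfect matchings of $G$, two perfect matchings $M_1,M_2$ being adjacent when $M_1\oplus M_2$ is the edge set of an inner face of $G$. A reducible face decomposition of a 2-connected plane bipartite graph $G$ with $n$ inner faces consists of subgraphs $G_1,\dots,G_n=G$ (with the embeddings inherited from $G$), inner faces $s_1,\dots,s_n$ of $G$, and paths (ears) $P_2,\dots,P_n$ of odd length such that $G_1=\partial s_1$ is the union of an edge and an odd length path joining the two ends of that edge and not containing it, and for every $2\le i\le n$: $P_i$ joins two vertices of $G_{i-1}$ belonging to different classes of the bipartition, has no internal vertex in $G_{i-1}$, and its edges are not in $G_{i-1}$ and lie in the exterior of $G_{i-1}$; $G_i=G_{i-1}\cup P_i$; and $P_i$ together with a path contained in the periphery of $G_{i-1}$ surrounds the inner face $s_i$. **Theorem.** Let $G$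 and $G'$ be 2-connected outerplane bipartite graphs. Then $R(G)$ and $R(G')$ are isomorphic if and only if $G$ and $G'$ have the same number $n$ of inner faces, $G$ has a reducible face decomposition $G_i$ $(1\le i\le n)$ with face sequence $s_i$ $(1\le i\le n)$ and odd length path sequence $P_i$ $(2\le i\le n)$, and $G'$ has a reducible face decomposition $G'_i$ $(1\le i\le n)$ with face sequence $s'_i$ $(1\le i\le n)$ and odd length path sequence $P'_i$ $(2\le i\le n)$, such that (i) the map $s_i\mapsto s'_i$ $(1\le i\le n)$ is an isomorphism from the inner dual of $G$ to the inner dual of $G'$; and (ii) $G$ and $G'$ have proper colourings with the colours black and white such that, for every $2\le i\le n$, the paths $P_i$ and $P'_i$, traversed in clockwise orientation along the peripheries of $G_i$ and $G'_i$ respectively, either both start at a black vertex and end at a white vertex, or both start at a white vertex and end at a black vertex. -/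

import Mathlib

universe u

/-- A graph is `2`-connected if it is connected, has at least three vertices, and stays connected
after the removal of any single vertex. -/
def SimpleGraph.IsTwoConnected {V : Type u} (G : SimpleGraph V) : Prop :=
  G.Connected ∧ 3 ≤ Nat.card V ∧ ∀ v : V, (G.induce {v}ᶜ).Connected

/-- The permutation of the darts (oriented edges) of `G` that reverses every dart. -/
def SimpleGraph.dartReversal {V : Type u} (G : SimpleGraph V) : Equiv.Perm G.Dart where
  toFun d := d.symm
  invFun d := d.symm
  left_inv d := d.symm_symm
  right_inv d := d.symm_symm

/-- An embedding of a connected finite graph with at least one edge in the oriented plane, up to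
orientation preserving homeomorphism, given as a combinatorial map: a rotation system (the cyclic
order of the edges around each vertex) of genus `0`, together with the choice of the outer
(infinite) face.

`rot d` is the dart that follows `d` in the counterclockwise order around the source `d.fst`.
The faces are the orbits of `d ↦ rot d.symm`; walking along such an orbit one always has the face
on the right-hand side.  Genus `0` is Euler's formula `V + F = E + 2`. -/
structure PlaneEmbedding {V : Type u} (G : SimpleGraph V) where
  connected : G.Connected
  rot : Equiv.Perm G.Dart
  rot_fst : ∀ d, (rot d).fst = d.fst
  rot_sameCycle : ∀ d d' : G.Dart, d.fst = d'.fst → rot.SameCycle d d'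
  outer : Quotient (Equiv.Perm.SameCycle.setoid (rot * G.dartReversal))
  euler : Nat.card V + Nat.card (Quotient (Equiv.Perm.SameCycle.setoid (rot * G.dartReversal)))
    = Nat.card G.edgeSet + 2

namespace PlaneEmbedding

variable {V : Type u} {G : SimpleGraph V}

/-- The faces of a plane graph, including the outer one. -/
def Face (E : PlaneEmbedding G) : Type u :=
  Quotient (Equiv.Perm.SameCycle.setoid (E.rot * G.dartReversal))

/-- The outer face. -/
def outerFace (E : PlaneEmbedding G) : E.Face := E.outer

/-- The face on the right-hand side of a dart.  The face on its left-hand side is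
`E.rightFace d.symm`. -/
def rightFace (E : PlaneEmbedding G) (d : G.Dart) : E.Face :=
  Quotient.mk (Equiv.Perm.SameCycle.setoid (E.rot * G.dartReversal)) d

/-- The inner (finite) faces. -/
def InnerFace (E : PlaneEmbedding G) : Type u := {f : E.Face // f ≠ E.outerFace}

/-- The set `E(f)` of the edges lying on the face `f`. -/
def faceEdges (E : PlaneEmbedding G) (f : E.Face) : Set (Sym2 V) :=
  {e | ∃ d : G.Dart, d.edge = e ∧ E.rightFace d = f}

/-- The periphery `∂f` of a face: the subgraph formed by the edges lying on it. -/
def periphery (E : PlaneEmbedding G) (f : E.Face) : G.Subgraph where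
  verts := {v | ∃ e ∈ E.faceEdges f, v ∈ e}
  Adj x y := s(x, y) ∈ E.faceEdges f
  adj_sub := by
    rintro x y ⟨d, hd, -⟩
    have h := d.edge_mem
    rw [hd] at h
    exact h
  edge_vert := fun {x y} h => ⟨s(x, y), h, Sym2.mem_mk_left x y⟩
  symm := ⟨fun x y h => by
    rw [Sym2.eq_swap]
    exact h⟩

/-- A plane graph is outerplane if every vertex lies on the outer face. -/
def IsOuterplane (E : PlaneEmbedding G) : Prop :=
  ∀ v : V, v ∈ (E.periphery E.outerFace).verts

/-- The inner dual: its vertices are the inner faces, and two (distinct) inner faces are adjacent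
when they have an edge in common. -/
def innerDual (E : PlaneEmbedding G) : SimpleGraph E.InnerFace where
  Adj f g := f ≠ g ∧ (E.faceEdges f.1 ∩ E.faceEdges g.1).Nonempty
  symm := ⟨fun f g h => ⟨h.1.symm, by
    rw [Set.inter_comm]
    exact h.2⟩⟩
  loopless := ⟨fun _ h => h.1 rfl⟩

theorem faceEdges_nonempty (E : PlaneEmbedding G) (f : E.Face) : (E.faceEdges f).Nonempty := by
  induction f using Quotient.inductionOn with
  | h d => exact ⟨d.edge, d, rfl, rfl⟩

/-- The resonance graph: its vertices are the perfect matchings of `G`, and two of them are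
adjacent when their symmetric difference is the edge set of an inner face. -/
def resonanceGraph (E : PlaneEmbedding G) :
    SimpleGraph {M : G.Subgraph // M.IsPerfectMatching} where
  Adj M N := ∃ f : E.InnerFace, symmDiff M.1.edgeSet N.1.edgeSet = E.faceEdges f.1
  symm := ⟨fun M N ⟨f, h⟩ => ⟨f, by rw [symmDiff_comm, h]⟩⟩
  loopless := ⟨fun M ⟨f, h⟩ => by
    rw [symmDiff_self] at h
    exact (E.faceEdges_nonempty f.1).ne_empty h.symm⟩

/-- The exterior of a subgraph `H` of the plane graph, that is, the outer face of `H` with the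
embedding inherited from `G`: the set of all faces of `G` that can be reached from the outer face
of `G` by crossing only edges that do not belong to `H`. -/
def exterior (E : PlaneEmbedding G) (H : G.Subgraph) : Set E.Face :=
  {f | Relation.ReflTransGen
    (fun f g => ∃ d : G.Dart, d.edge ∉ H.edgeSet ∧ E.rightFace d = f ∧ E.rightFace d.symm = g)
    E.outerFace f}

/-- The edges on the periphery of a subgraph `H`: the edges of `H` that have the exterior of `H`
on (at least) one of their two sides. -/
def outerEdges (E : PlaneEmbedding G) (H : G.Subgraph) : Set (Sym2 V) :=
  {e | e ∈ H.edgeSet ∧ ∃ d : G.Dart, d.edge = e ∧ E.rightFace d ∈ E.exterior H}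

/-- The walk `p` runs along the periphery of the subgraph `H` in clockwise orientation: each of
its darts is an edge of `H` with the exterior of `H` on the left-hand side. -/
def RunsClockwise (E : PlaneEmbedding G) (H : G.Subgraph) {x y : V} (p : G.Walk x y) : Prop :=
  ∀ d ∈ p.darts, d.edge ∈ H.edgeSet ∧ E.rightFace d.symm ∈ E.exterior H

/-- A reducible face decomposition `RFD(G₁, …, Gₙ)` of a plane bipartite graph with `n = m + 1`
inner faces.  The graphs `Gᵢ` and the faces `sᵢ` (`1 ≤ i ≤ n`) are indexed from `0` by
`Fin (m + 1)`; the ear added when passing from `sub i.castSucc` to `sub i.succ` is `ear i`.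

The two ends of an ear lie in different classes of the bipartition, because its length is odd. -/
structure ReducibleFaceDecomposition (E : PlaneEmbedding G) (m : ℕ) where
  card_innerFace : Nat.card E.InnerFace = m + 1
  sub : Fin (m + 1) → G.Subgraph
  face : Fin (m + 1) → E.InnerFace
  earStart : Fin m → V
  earEnd : Fin m → V
  ear : ∀ i : Fin m, G.Walk (earStart i) (earEnd i)
  /-- The first graph is the periphery of an inner face ... -/
  sub_zero : sub 0 = E.periphery (face 0).1
  /-- ... and it consists of an edge and a path of odd length joining the ends of that edge. -/
  sub_zero_eq : ∃ (x y : V) (e : G.Adj x y) (p : G.Walk x y),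
    p.IsPath ∧ Odd p.length ∧ s(x, y) ∉ p.edges ∧ sub 0 = G.subgraphOfAdj e ⊔ p.toSubgraph
  ear_isPath : ∀ i, (ear i).IsPath
  ear_odd : ∀ i, Odd (ear i).length
  /-- The ear joins two vertices of the previous graph ... -/
  earStart_mem : ∀ i, earStart i ∈ (sub i.castSucc).verts
  earEnd_mem : ∀ i, earEnd i ∈ (sub i.castSucc).verts
  /-- ... has no internal vertex in common with it ... -/
  ear_internal : ∀ i, ∀ v ∈ (ear i).support, v ∈ (sub i.castSucc).verts →
    v = earStart i ∨ v = earEnd i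
  /-- ... and its edges are new and lie in the exterior of the previous graph. -/
  ear_exterior : ∀ i, ∀ d ∈ (ear i).darts,
    d.edge ∉ (sub i.castSucc).edgeSet ∧ E.rightFace d ∈ E.exterior (sub i.castSucc)
  /-- The ear and a part of the periphery of the previous graph surround the next face. -/
  ear_surrounds : ∀ i, ∃ q : G.Walk (earStart i) (earEnd i), q.IsPath ∧
    (∀ e ∈ q.edges, e ∈ E.outerEdges (sub i.castSucc)) ∧
    E.faceEdges (face i.succ).1 = {e | e ∈ (ear i).edges ∨ e ∈ q.edges}
  sub_succ : ∀ i : Fin m, sub i.succ = sub i.castSucc ⊔ (ear i).toSubgraph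
  sub_last : sub (Fin.last m) = ⊤

end PlaneEmbedding

/-! # Resonance graphs of outerplane bipartite graphs

Both sides of the equivalence say that the inner duals, oriented by the colours, are isomorphic up
to a reversal of all arrows.

*Planarity.*  The only consequence of Euler's formula that is used is that every circulation on the
darts is the coboundary of a function on the faces (`exists_potential`): coboundaries of face
functions and gradients of vertex functions are orthogonal, and Euler's formula says that together
they fill the space of antisymmetric functions.  Applied to closed walks, this shows that in a
`2`-connected plane graph a face passes at most once through a vertex (`rightFace_injective_at`),
and that in an outerplane graph every inner edge separates the inner faces (`exists_cut`).  So the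
inner dual is a tree, in a form convenient for the rest.

*Matchings.*  Fix a proper colouring.  An inner edge, traversed from its vertex of colour `true`,
has a face on its right and one on its left; the first is taken to precede the second.  The
difference of a perfect matching with the perfect matching formed by every other edge of the outer
cycle is a circulation, and its potential takes only the values `0` and `1`, because every face has
a vertex in common with the outer face.  This identifies perfect matchings with sets of inner faces
closed under predecessors, and edges of the resonance graph with pairs of such sets that differ in
one face (`nonempty_idealGraph_iso`).  The resonance graph is thus the undirected Hasse diagram of
the distributive lattice of order ideals of an oriented tree.

*Reconstruction.*  That undirected graph determines the oriented tree up to reversal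
(`exists_equiv_of_idealGraph_iso`).  Edges that change the same element are linked by squares, so
an isomorphism relabels the elements; after relabelling it is the symmetric difference with a fixed
set, and that set must be empty or everything since the tree is connected.

*Decompositions.*  In a reducible face decomposition each new face is glued along a single edge,
and a clockwise ear runs from one end of that edge to the other with the new face on its right.  So
the colours of the ends of the ear record the orientation of the arrow of the inner dual crossing
that edge (`dart_eq_of_clockwise`).  Conversely any enumeration of the inner faces in which each one
is adjacent to an earlier one comes from a decomposition (`exists_decomposition`).
-/

open SimpleGraph

/-! ### Flows and face potentials -/

namespace SimpleGraph

variable {V : Type u} {G : SimpleGraph V}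

instance Dart.finite [Finite V] : Finite G.Dart :=
  Finite.of_injective (fun d : G.Dart => d.toProd) Dart.toProd_injective

theorem dartReversal_apply (d : G.Dart) : G.dartReversal d = d.symm := rfl

/-- A circulation with rational values on a graph: an antisymmetric function on the darts whose
total value on the darts leaving any given vertex is `0`.  The conservation law is expressed by
testing against functions on the vertices. -/
def IsFlow [Fintype G.Dart] (w : G.Dart → ℚ) : Prop :=
  (∀ d, w d.symm = -w d) ∧ ∀ p : V → ℚ, ∑ d, w d * p d.fst = 0

/-- The number of times that a walk uses a dart, minus the number of times that it uses the
reversed dart. -/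
noncomputable def walkFlow {x y : V} (p : G.Walk x y) (d : G.Dart) : ℚ :=
  open Classical in (p.darts.count d : ℚ) - p.darts.count d.symm

theorem walkFlow_symm {x y : V} (p : G.Walk x y) (d : G.Dart) :
    walkFlow p d.symm = -walkFlow p d := by
  simp [walkFlow]

theorem walkFlow_cons {x y z : V} (h : G.Adj x y) (p : G.Walk y z) (d : G.Dart) :
    walkFlow (Walk.cons h p) d = walkFlow p d +
      (open Classical in (if d = ⟨(x, y), h⟩ then 1 else 0) -
        (if d = Dart.symm ⟨(x, y), h⟩ then 1 else 0)) := by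
  classical
  have h1 : (Dart.mk (x, y) h = d.symm) ↔ d = Dart.symm ⟨(x, y), h⟩ := by
    constructor
    · intro e; rw [e, Dart.symm_symm]
    · rintro rfl; rw [Dart.symm_symm]
  simp only [walkFlow, Walk.darts_cons, List.count_cons, beq_iff_eq, h1, eq_comm (b := d)]
  push_cast
  ring

theorem walkFlow_eq_zero {x y : V} (p : G.Walk x y) (d : G.Dart) (h1 : d ∉ p.darts)
    (h2 : d.symm ∉ p.darts) : walkFlow p d = 0 := by
  classical
  simp [walkFlow, List.count_eq_zero_of_not_mem h1, List.count_eq_zero_of_not_mem h2]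

theorem sum_walkFlow_mul [Fintype G.Dart] {x y : V} (p : G.Walk x y) (f : V → ℚ) :
    ∑ d, walkFlow p d * f d.fst = f x - f y := by
  classical
  induction p with
  | nil => simp [walkFlow]
  | cons h p ih =>
    simp only [walkFlow_cons, add_mul, Finset.sum_add_distrib, ih, sub_mul, ite_mul, one_mul,
      zero_mul, Finset.sum_sub_distrib, Finset.sum_ite_eq', Finset.mem_univ, if_true]
    simp [Dart.symm]

theorem isFlow_walkFlow [Fintype G.Dart] {x : V} (p : G.Walk x x) : IsFlow (walkFlow p) :=
  ⟨walkFlow_symm p, fun f => by rw [sum_walkFlow_mul, sub_self]⟩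

end SimpleGraph

namespace PlaneEmbedding

variable {V : Type u} {G : SimpleGraph V} (E : PlaneEmbedding G)

/-- The permutation of the darts whose orbits are the faces: it sends a dart to the next dart
along the boundary of the face on its right-hand side. -/
def facePerm : Equiv.Perm G.Dart := E.rot * G.dartReversal

theorem facePerm_apply (d : G.Dart) : E.facePerm d = E.rot d.symm := rfl

theorem facePerm_fst (d : G.Dart) : (E.facePerm d).fst = d.snd := by
  rw [facePerm_apply, E.rot_fst]; rfl

theorem rightFace_eq_iff {d d' : G.Dart} :
    E.rightFace d = E.rightFace d' ↔ E.facePerm.SameCycle d d' :=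
  Quotient.eq (r := Equiv.Perm.SameCycle.setoid (E.rot * G.dartReversal))

theorem rightFace_facePerm (d : G.Dart) : E.rightFace (E.facePerm d) = E.rightFace d := by
  rw [rightFace_eq_iff, Equiv.Perm.sameCycle_apply_left]

/-- The face on the left-hand side of a dart is on the right-hand side of the next dart in the
rotation around its source. -/
theorem rightFace_rot (d : G.Dart) : E.rightFace (E.rot d) = E.rightFace d.symm := by
  rw [← E.rightFace_facePerm d.symm, facePerm_apply, Dart.symm_symm]

theorem exists_rightFace (f : E.Face) : ∃ d, E.rightFace d = f :=
  Quotient.exists_rep f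

instance finite_face [Finite V] : Finite E.Face :=
  Finite.of_surjective E.rightFace E.exists_rightFace

instance finite_innerFace [Finite V] : Finite E.InnerFace :=
  inferInstanceAs (Finite {f : E.Face // f ≠ E.outerFace})

/-- A property of darts that is preserved by the rotation around a vertex spreads to all darts
leaving that vertex. -/
theorem of_rot_closed [Finite V] {P : G.Dart → Prop} {d d' : G.Dart}
    (hP : ∀ a : G.Dart, a.fst = d.fst → P a → P (E.rot a)) (h : d.fst = d'.fst) (hd : P d) :
    P d' := by
  obtain ⟨i, rfl⟩ := (E.rot_sameCycle d d' h).exists_nat_pow_eq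
  clear h
  suffices ((E.rot ^ i) d).fst = d.fst ∧ P ((E.rot ^ i) d) from this.2
  induction i with
  | zero => exact ⟨rfl, hd⟩
  | succ n ih =>
    rw [pow_succ', Equiv.Perm.mul_apply]
    exact ⟨(E.rot_fst _).trans ih.1, hP _ ih.1 ih.2⟩

/-- If a property of darts can only change when the rotation around a vertex passes through the
dart `d₀`, then all other darts leaving that vertex agree about it. -/
theorem iff_of_rot_iff [Finite V] {P : G.Dart → Prop} {d₀ d d' : G.Dart}
    (hP : ∀ a : G.Dart, a.fst = d₀.fst → a ≠ d₀ → E.rot a ≠ d₀ → (P a ↔ P (E.rot a)))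
    (h : d.fst = d₀.fst) (h' : d'.fst = d₀.fst) (hd : d ≠ d₀) (hd' : d' ≠ d₀) : P d ↔ P d' := by
  suffices H : ∀ d d' : G.Dart, d.fst = d₀.fst → d'.fst = d₀.fst → d ≠ d₀ → d' ≠ d₀ →
      P d → P d' from ⟨H d d' h h' hd hd', H d' d h' h hd' hd⟩
  clear h h' hd hd' d d'
  intro d d' h h' hd hd' hPd
  by_contra hPd'
  by_cases h1 : E.rot d₀ = d₀
  · exact hd (E.of_rot_closed (P := fun a => a = d₀) (d := d₀) (d' := d)
      (fun a _ ha => by rw [ha, h1]) h.symm rfl)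
  -- The darts on which `P` takes the same value as at `rot d₀` form, with `d₀`, a closed set.
  by_cases h2 : P (E.rot d₀)
  · rcases E.of_rot_closed (P := fun a => a = d₀ ∨ P a) (d := d₀) (d' := d') (fun a ha hPa => by
      by_cases h3 : E.rot a = d₀
      · exact Or.inl h3
      · by_cases h4 : a = d₀
        · rw [h4]; exact Or.inr h2
        · exact Or.inr ((hP a ha h4 h3).1 (hPa.resolve_left h4))) h'.symm (Or.inl rfl) with h5 | h5
    · exact hd' h5
    · exact hPd' h5
  · rcases E.of_rot_closed (P := fun a => a = d₀ ∨ ¬P a) (d := d₀) (d' := d) (fun a ha hPa => by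
      by_cases h3 : E.rot a = d₀
      · exact Or.inl h3
      · by_cases h4 : a = d₀
        · rw [h4]; exact Or.inr h2
        · exact Or.inr fun h6 => (hPa.resolve_left h4) ((hP a ha h4 h3).2 h6))
      h.symm (Or.inl rfl) with h5 | h5
    · exact hd h5
    · exact h5 hPd

/-- The faces are connected through the edges: a function that takes the same value on both sides
of every edge is constant. -/
theorem potential_const [Finite V] {h : E.Face → ℚ}
    (hh : ∀ d, h (E.rightFace d) = h (E.rightFace d.symm)) (f g : E.Face) : h f = h g := by
  obtain ⟨a, rfl⟩ := E.exists_rightFace f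
  obtain ⟨b, rfl⟩ := E.exists_rightFace g
  have key : ∀ a b : G.Dart, a.fst = b.fst → h (E.rightFace a) = h (E.rightFace b) :=
    fun a b hab => E.of_rot_closed (P := fun c => h (E.rightFace a) = h (E.rightFace c))
      (fun c _ hc => by rw [hc, hh c, E.rightFace_rot]) hab rfl
  obtain ⟨p⟩ := E.connected.preconnected a.fst b.fst
  suffices ∀ (x y : V) (p : G.Walk x y) (a b : G.Dart), a.fst = x → b.fst = y →
      h (E.rightFace a) = h (E.rightFace b) from this _ _ p a b rfl rfl
  clear p a b
  intro x y p
  induction p with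
  | nil => exact fun a b ha hb => key a b (ha.trans hb.symm)
  | @cons x z y hxz p ih =>
    intro a b ha hb
    rw [key a ⟨(x, z), hxz⟩ ha, hh]
    exact ih _ _ rfl hb

theorem vertex_const (E : PlaneEmbedding G) {p : V → ℚ} (hp : ∀ d : G.Dart, p d.snd = p d.fst)
    (x y : V) : p x = p y := by
  obtain ⟨q⟩ := E.connected.preconnected x y
  induction q with
  | nil => rfl
  | @cons x z y h q ih => exact (hp ⟨(x, z), h⟩).symm.trans ih

/-- Coboundaries of face functions are orthogonal to gradients of vertex functions. -/
theorem sum_rightFace_mul_grad [Fintype G.Dart] (h : E.Face → ℚ) (p : V → ℚ) :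
    ∑ d : G.Dart, h (E.rightFace d) * (p d.snd - p d.fst) = 0 := by
  have h1 : ∑ d : G.Dart, h (E.rightFace d) * p d.snd
      = ∑ d : G.Dart, h (E.rightFace d) * p d.fst := by
    rw [← Equiv.sum_comp E.facePerm (fun d : G.Dart => h (E.rightFace d) * p d.fst)]
    exact Finset.sum_congr rfl fun d _ => by rw [E.rightFace_facePerm, E.facePerm_fst]
  simp only [mul_sub, Finset.sum_sub_distrib, h1, sub_self]

theorem sum_coboundary_mul_grad [Fintype G.Dart] (h : E.Face → ℚ) (p : V → ℚ) :
    ∑ d : G.Dart, (h (E.rightFace d) - h (E.rightFace d.symm)) * (p d.snd - p d.fst) = 0 := by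
  have h1 : ∑ d : G.Dart, h (E.rightFace d.symm) * (p d.snd - p d.fst) = 0 := by
    rw [← Equiv.sum_comp G.dartReversal]
    have h2 := E.sum_rightFace_mul_grad h p
    rw [← neg_eq_zero, ← Finset.sum_neg_distrib] at h2
    rw [← h2]
    refine Finset.sum_congr rfl fun d _ => ?_
    rw [dartReversal_apply, Dart.symm_symm]
    change h (E.rightFace d) * (p d.fst - p d.snd) = _
    ring
  simp only [sub_mul _ _ (p _ - p _), Finset.sum_sub_distrib, h1, E.sum_rightFace_mul_grad,
    sub_self]

theorem grad_eq_zero [Fintype G.Dart] {h : E.Face → ℚ} {p : V → ℚ}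
    (hs : ∑ d : G.Dart, (h (E.rightFace d) - h (E.rightFace d.symm) + (p d.snd - p d.fst)) *
      (p d.snd - p d.fst) = 0) (d : G.Dart) : p d.snd = p d.fst := by
  simp only [add_mul _ _ (p _ - p _), Finset.sum_add_distrib, E.sum_coboundary_mul_grad,
    zero_add] at hs
  exact sub_eq_zero.1 (mul_self_eq_zero.1 ((Finset.sum_eq_zero_iff_of_nonneg
    fun _ _ => mul_self_nonneg _).1 hs d (Finset.mem_univ d)))

/-- Every antisymmetric function on the darts is the sum of a coboundary of a face function and
a gradient of a vertex function.  The two spaces are orthogonal, so this is a count of dimensions,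
and it is exactly what Euler's formula provides. -/
theorem exists_hodge [Finite V] {w : G.Dart → ℚ} (hw : ∀ d, w d.symm = -w d) :
    ∃ (h : E.Face → ℚ) (p : V → ℚ),
      ∀ d, w d = h (E.rightFace d) - h (E.rightFace d.symm) + (p d.snd - p d.fst) := by
  classical
  have := Fintype.ofFinite V
  have := Fintype.ofFinite G.Dart
  have := Fintype.ofFinite E.Face
  have := Fintype.ofFinite G.edgeSet
  have hex : ∀ e : G.edgeSet, ∃ d : G.Dart, d.edge = e := by
    rintro ⟨e, he⟩
    induction e with
    | h x y => exact ⟨⟨(x, y), he⟩, rfl⟩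
  choose r hr using hex
  have extend : ∀ w₁ w₂ : G.Dart → ℚ, (∀ d, w₁ d.symm = -w₁ d) → (∀ d, w₂ d.symm = -w₂ d) →
      (∀ e, w₁ (r e) = w₂ (r e)) → ∀ d, w₁ d = w₂ d := by
    intro w₁ w₂ h₁ h₂ h d
    rcases (dart_edge_eq_iff _ _).1 (hr ⟨d.edge, d.edge_mem⟩) with h3 | h3
    · rw [← h3, h]
    · have h4 := h ⟨d.edge, d.edge_mem⟩
      rw [h3, h₁, h₂] at h4
      exact neg_injective h4
  have anti : ∀ (h : E.Face → ℚ) (p : V → ℚ) (d : G.Dart),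
      h (E.rightFace d.symm) - h (E.rightFace d.symm.symm) + (p d.symm.snd - p d.symm.fst)
        = -(h (E.rightFace d) - h (E.rightFace d.symm) + (p d.snd - p d.fst)) := by
    intro h p d
    rw [Dart.symm_symm]
    change _ - _ + (p d.fst - p d.snd) = _
    ring
  let Ψ : ((E.Face → ℚ) × (V → ℚ)) →ₗ[ℚ] (G.edgeSet → ℚ) :=
    { toFun := fun x e => x.1 (E.rightFace (r e)) - x.1 (E.rightFace (r e).symm)
        + (x.2 (r e).snd - x.2 (r e).fst)
      map_add' := fun x y => by
        funext e
        simp only [Prod.fst_add, Prod.snd_add, Pi.add_apply]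
        ring
      map_smul' := fun a x => by
        funext e
        simp only [Prod.smul_fst, Prod.smul_snd, Pi.smul_apply, smul_eq_mul, RingHom.id_apply]
        ring }
  obtain ⟨v₀⟩ := E.connected.nonempty
  let ev : ((E.Face → ℚ) × (V → ℚ)) →ₗ[ℚ] ℚ × ℚ :=
    { toFun := fun x => (x.1 E.outerFace, x.2 v₀)
      map_add' := fun _ _ => rfl
      map_smul' := fun _ _ => rfl }
  have hker : Function.Injective (ev.comp (LinearMap.ker Ψ).subtype) := by
    rw [← LinearMap.ker_eq_bot, LinearMap.ker_eq_bot']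
    rintro ⟨⟨h, p⟩, hx⟩ h0
    have hx' : ∀ d, h (E.rightFace d) - h (E.rightFace d.symm) + (p d.snd - p d.fst) = 0 :=
      extend (fun d => h (E.rightFace d) - h (E.rightFace d.symm) + (p d.snd - p d.fst))
        (fun _ => 0) (anti h p) (by simp) (fun e => congrFun (LinearMap.mem_ker.1 hx) e)
    have hp := E.grad_eq_zero (h := h) (p := p)
      (Finset.sum_eq_zero fun d _ => by rw [hx' d, zero_mul])
    have hh : ∀ d, h (E.rightFace d) = h (E.rightFace d.symm) := fun d => by
      have h1 := hx' d
      rw [hp d, sub_self, add_zero] at h1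
      exact sub_eq_zero.1 h1
    have h1 : h E.outerFace = 0 := congrArg Prod.fst h0
    have h2 : p v₀ = 0 := congrArg Prod.snd h0
    refine Subtype.ext (Prod.ext (funext fun f => ?_) (funext fun v => ?_))
    · exact (E.potential_const hh f E.outerFace).trans h1
    · exact (E.vertex_const hp v v₀).trans h2
  have hdim := LinearMap.finrank_le_finrank_of_injective hker
  have hrank := LinearMap.finrank_range_add_finrank_ker Ψ
  have heuler : Nat.card V + Nat.card E.Face = Nat.card G.edgeSet + 2 := E.euler
  rw [Module.finrank_prod, Module.finrank_self] at hdim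
  rw [Module.finrank_prod, Module.finrank_fintype_fun_eq_card,
    Module.finrank_fintype_fun_eq_card, ← Nat.card_eq_fintype_card,
    ← Nat.card_eq_fintype_card] at hrank
  have htop : LinearMap.range Ψ = ⊤ := by
    apply Submodule.eq_top_of_finrank_eq
    apply le_antisymm (Submodule.finrank_le _)
    rw [Module.finrank_fintype_fun_eq_card, ← Nat.card_eq_fintype_card]
    omega
  obtain ⟨⟨h, p⟩, hhp⟩ := LinearMap.range_eq_top.1 htop (fun e => w (r e))
  exact ⟨h, p, extend w _ hw (anti h p) fun e => (congrFun hhp e).symm⟩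

/-- In the plane every circulation has a potential on the faces. -/
theorem exists_potential [Finite V] [Fintype G.Dart] {w : G.Dart → ℚ} (hw : IsFlow w) :
    ∃ h : E.Face → ℚ, ∀ d, w d = h (E.rightFace d) - h (E.rightFace d.symm) := by
  obtain ⟨h, p, hhp⟩ := E.exists_hodge hw.1
  have hp := E.grad_eq_zero (h := h) (p := p) (by
    have h1 : ∑ d : G.Dart, w d * p d.snd = 0 := by
      rw [← Equiv.sum_comp G.dartReversal]
      have h2 := hw.2 p
      rw [← neg_eq_zero, ← Finset.sum_neg_distrib] at h2
      rw [← h2]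
      refine Finset.sum_congr rfl fun d _ => ?_
      rw [dartReversal_apply, hw.1, neg_mul]
      rfl
    simp only [← hhp, mul_sub, Finset.sum_sub_distrib, h1, hw.2 p, sub_self])
  exact ⟨h, fun d => by rw [hhp d, hp d, sub_self, add_zero]⟩

end PlaneEmbedding

/-! ### Faces around a vertex, and chords -/

namespace SimpleGraph

variable {V : Type u} {G : SimpleGraph V}

theorem IsTwoConnected.exists_walk_avoiding (hG : G.IsTwoConnected) {v x y : V} (hx : x ≠ v)
    (hy : y ≠ v) : ∃ p : G.Walk x y, v ∉ p.support := by
  obtain ⟨q⟩ := (hG.2.2 v).preconnected ⟨x, hx⟩ ⟨y, hy⟩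
  have key : ∀ a b (q : (G.induce {v}ᶜ).Walk a b),
      v ∉ (q.map (Embedding.induce {v}ᶜ).toHom).support := fun a b q h => by
    rw [Walk.support_map, List.mem_map] at h
    obtain ⟨⟨z, hz⟩, -, h⟩ := h
    exact hz h
  exact ⟨q.map (Embedding.induce {v}ᶜ).toHom, key _ _ q⟩

theorem IsTwoConnected.exists_ne_adj (hG : G.IsTwoConnected) [Finite V] (v w : V) :
    ∃ x, x ≠ w ∧ G.Adj v x := by
  classical
  have := Fintype.ofFinite V
  by_cases hvw : v = w
  · subst hvw
    have : Nontrivial V := Finite.one_lt_card_iff_nontrivial.1 (by have := hG.2.1; omega)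
    obtain ⟨x, hx⟩ := hG.1.preconnected.exists_adj_of_nontrivial v
    exact ⟨x, hx.ne', hx⟩
  · obtain ⟨z, hz⟩ : ∃ z, z ∉ ({v, w} : Finset V) := by
      by_contra! h
      have h1 := hG.2.1
      have h2 : Nat.card V ≤ ({v, w} : Finset V).card := by
        rw [Nat.card_eq_fintype_card]
        exact Finset.card_le_card fun x _ => h x
      have := Finset.card_le_two (a := v) (b := w)
      omega
    simp only [Finset.mem_insert, Finset.mem_singleton, not_or] at hz
    obtain ⟨p, hp⟩ := hG.exists_walk_avoiding hvw hz.2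
    cases p with
    | nil => exact absurd rfl hz.1
    | @cons _ y _ h p =>
      refine ⟨y, fun hy => hp ?_, h⟩
      rw [Walk.support_cons, ← hy]
      exact List.mem_cons_of_mem _ p.start_mem_support

end SimpleGraph

namespace PlaneEmbedding

variable {V : Type u} {G : SimpleGraph V} (E : PlaneEmbedding G)

theorem mem_periphery_verts_iff {f : E.Face} {v : V} :
    v ∈ (E.periphery f).verts ↔ ∃ d : G.Dart, d.fst = v ∧ E.rightFace d = f := by
  constructor
  · rintro ⟨e, ⟨d, rfl, hd⟩, hv⟩
    rcases (Sym2.mem_iff (a := v) (b := d.fst) (c := d.snd)).1 hv with rfl | rfl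
    · exact ⟨d, rfl, hd⟩
    · exact ⟨E.facePerm d, E.facePerm_fst d, (E.rightFace_facePerm d).trans hd⟩
  · rintro ⟨d, rfl, hd⟩
    exact ⟨d.edge, ⟨d, rfl, hd⟩, Sym2.mem_mk_left _ _⟩

/-- In an outerplane graph every vertex is the source of a dart of the outer face. -/
theorem IsOuterplane.exists_dart {E : PlaneEmbedding G} (hE : E.IsOuterplane) (v : V) :
    ∃ d : G.Dart, d.fst = v ∧ E.rightFace d = E.outerFace :=
  E.mem_periphery_verts_iff.1 (hE v)

variable [Finite V]

/-- In a `2`-connected plane graph a face visits a vertex at most once: a closed walk leaving the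
vertex through one of two visits and returning through the other would give different potentials
to the two corners. -/
theorem rightFace_injective_at (hG : G.IsTwoConnected) {a b : G.Dart} (h : a.fst = b.fst)
    (hf : E.rightFace a = E.rightFace b) : a = b := by
  classical
  have := Fintype.ofFinite G.Dart
  by_contra hab
  obtain ⟨⟨v, x⟩, hvx⟩ := a
  obtain ⟨⟨v', y⟩, hvy⟩ := b
  obtain rfl : v = v' := h
  obtain ⟨p, hp⟩ := hG.exists_walk_avoiding hvx.ne' hvy.ne'
  obtain ⟨k, hk⟩ := E.exists_potential (isFlow_walkFlow (Walk.cons hvy.symm (Walk.cons hvx p)))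
  have hval : ∀ d : G.Dart, d.fst = v → k (E.rightFace (E.rot d)) = k (E.rightFace d)
      - ((if d = ⟨(v, x), hvx⟩ then 1 else 0) - if d = ⟨(v, y), hvy⟩ then 1 else 0) := by
    intro d hd
    have h1 : walkFlow p d = 0 := by
      apply walkFlow_eq_zero
      · exact fun h => hp (hd ▸ p.dart_fst_mem_support_of_mem_darts h)
      · exact fun h => hp (hd ▸ p.dart_snd_mem_support_of_mem_darts h)
    have h2 := hk d
    have h3 : d ≠ Dart.symm ⟨(v, x), hvx⟩ := by
      rintro rfl
      exact hvx.ne' hd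
    have h4 : d ≠ ⟨(y, v), hvy.symm⟩ := by
      rintro rfl
      exact hvy.ne' hd
    have h5 : Dart.symm ⟨(y, v), hvy.symm⟩ = ⟨(v, y), hvy⟩ := rfl
    rw [walkFlow_cons, walkFlow_cons, h1, if_neg h3, if_neg h4, h5] at h2
    rw [E.rightFace_rot]
    linarith
  -- After the first of the two corners the potential has dropped, and it never recovers.
  have hcl := E.of_rot_closed (d := E.rot ⟨(v, x), hvx⟩) (d' := ⟨(v, x), hvx⟩)
    (P := fun d => k (E.rightFace d) = k (E.rightFace ⟨(v, x), hvx⟩) - 1) (fun d hd hkd => by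
      rw [E.rot_fst] at hd
      have h1 : d ≠ ⟨(v, x), hvx⟩ := by
        rintro rfl
        linarith
      have h2 : d ≠ ⟨(v, y), hvy⟩ := by
        rintro rfl
        rw [← hf] at hkd
        linarith
      rw [hval d hd, if_neg h1, if_neg h2, hkd]
      ring) (E.rot_fst _) (by
      rw [hval _ rfl, if_pos rfl, if_neg hab]
      ring)
  linarith

theorem rightFace_symm_ne (hG : G.IsTwoConnected) (d : G.Dart) :
    E.rightFace d.symm ≠ E.rightFace d := by
  intro h
  rw [← E.rightFace_rot] at h
  have h1 := E.rightFace_injective_at hG (E.rot_fst d) h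
  obtain ⟨x, hx, hadj⟩ := hG.exists_ne_adj d.fst d.snd
  have h2 := E.of_rot_closed (P := fun a => a = d) (d := d) (d' := ⟨(d.fst, x), hadj⟩)
    (fun a _ ha => by rw [ha, h1]) rfl rfl
  exact hx (by rw [← h2])

/-- One can walk from one dart of a face to another along the boundary of the face. -/
theorem exists_walk_of_rightFace_eq {a b : G.Dart} (h : E.rightFace a = E.rightFace b) :
    ∃ p : G.Walk a.fst b.fst, ∀ d ∈ p.darts, E.rightFace d = E.rightFace a := by
  obtain ⟨i, rfl⟩ := (E.rightFace_eq_iff.1 h).exists_nat_pow_eq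
  clear h
  induction i generalizing a with
  | zero => exact ⟨Walk.nil, fun d hd => absurd hd List.not_mem_nil⟩
  | succ n ih =>
    obtain ⟨p, hp⟩ := ih (a := E.facePerm a)
    rw [pow_succ, Equiv.Perm.mul_apply]
    have hf := E.facePerm_fst a
    refine ⟨Walk.cons a.adj (p.copy hf rfl), fun d hd => ?_⟩
    rw [Walk.darts_cons, List.mem_cons, Walk.darts_copy] at hd
    rcases hd with rfl | hd
    · rfl
    · rw [hp d hd, E.rightFace_facePerm]

/-- Every inner edge is a chord that separates the inner faces: there is a function on the faces
that changes across that edge and across no other inner edge.  It is the potential of the closed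
walk formed by the chord and a part of the outer cycle. -/
theorem exists_cut (hE : E.IsOuterplane) {d : G.Dart} (h1 : E.rightFace d ≠ E.outerFace)
    (h2 : E.rightFace d.symm ≠ E.outerFace) :
    ∃ S : Set E.Face, E.rightFace d ∈ S ∧ E.rightFace d.symm ∉ S ∧
      ∀ a : G.Dart, E.rightFace a ≠ E.outerFace → E.rightFace a.symm ≠ E.outerFace →
        a.edge ≠ d.edge → (E.rightFace a ∈ S ↔ E.rightFace a.symm ∈ S) := by
  classical
  have := Fintype.ofFinite G.Dart
  obtain ⟨a, ha, hao⟩ := hE.exists_dart d.snd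
  obtain ⟨b, hb, hbo⟩ := hE.exists_dart d.fst
  obtain ⟨p, hp⟩ := E.exists_walk_of_rightFace_eq (hao.trans hbo.symm)
  have hflow : ∀ c : G.Dart, E.rightFace c ≠ E.outerFace → E.rightFace c.symm ≠ E.outerFace →
      walkFlow (p.copy ha hb) c = 0 := fun c hc hc' =>
    walkFlow_eq_zero _ _
      (fun h => hc ((hp c (by rwa [Walk.darts_copy] at h)).trans hao))
      (fun h => hc' ((hp c.symm (by rwa [Walk.darts_copy] at h)).trans hao))
  obtain ⟨k, hk⟩ := E.exists_potential (isFlow_walkFlow (Walk.cons d.adj (p.copy ha hb)))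
  refine ⟨{f | k f = k (E.rightFace d)}, rfl, fun h => ?_, fun c hc hc' hcd => ?_⟩
  · have h3 := hk d
    rw [walkFlow_cons, hflow d h1 h2, if_pos rfl, if_neg d.symm_ne.symm] at h3
    have h4 : k (E.rightFace d.symm) = k (E.rightFace d) := h
    linarith
  · have h3 := hk c
    rw [walkFlow_cons, hflow c hc hc', if_neg (fun h => hcd (by rw [h])),
      if_neg (fun h => hcd (by rw [h, Dart.edge_symm]))] at h3
    have h4 : k (E.rightFace c) = k (E.rightFace c.symm) := by linarith
    rw [Set.mem_ofPred_eq, Set.mem_ofPred_eq, h4]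

/-- Around a vertex, a property of the inner faces that does not change across the inner edges at
that vertex is constant. -/
theorem iff_of_inner_at (hG : G.IsTwoConnected) (hE : E.IsOuterplane) {P : E.Face → Prop}
    {a b : G.Dart} (hab : a.fst = b.fst)
    (hP : ∀ d : G.Dart, d.fst = a.fst → E.rightFace d ≠ E.outerFace →
      E.rightFace d.symm ≠ E.outerFace → (P (E.rightFace d) ↔ P (E.rightFace d.symm)))
    (ha : E.rightFace a ≠ E.outerFace) (hb : E.rightFace b ≠ E.outerFace) :
    P (E.rightFace a) ↔ P (E.rightFace b) := by
  obtain ⟨o, ho, hoo⟩ := hE.exists_dart a.fst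
  have key : ∀ d : G.Dart, d.fst = a.fst → d ≠ o → E.rightFace d ≠ E.outerFace :=
    fun d hd hne h => hne (E.rightFace_injective_at hG (hd.trans ho.symm) (h.trans hoo.symm))
  refine E.iff_of_rot_iff (P := fun d => P (E.rightFace d)) (d₀ := o) ?_ ho.symm
    (hab.symm.trans ho.symm) (fun h => ha (h ▸ hoo)) (fun h => hb (h ▸ hoo))
  intro d hd h1 h2
  have h3 := key _ ((E.rot_fst d).trans (hd.trans ho)) h2
  rw [E.rightFace_rot] at h3 ⊢
  exact hP d (hd.trans ho) (key d (hd.trans ho) h1) h3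

/-- The inner faces are connected through the inner edges. -/
theorem inner_connected (hG : G.IsTwoConnected) (hE : E.IsOuterplane) {P : E.Face → Prop}
    (hP : ∀ d : G.Dart, E.rightFace d ≠ E.outerFace →
      E.rightFace d.symm ≠ E.outerFace → (P (E.rightFace d) ↔ P (E.rightFace d.symm)))
    {f g : E.Face} (hf : f ≠ E.outerFace) (hg : g ≠ E.outerFace) : P f ↔ P g := by
  obtain ⟨a, rfl⟩ := E.exists_rightFace f
  obtain ⟨b, rfl⟩ := E.exists_rightFace g
  obtain ⟨p⟩ := E.connected.preconnected a.fst b.fst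
  suffices ∀ (x y : V) (p : G.Walk x y) (a b : G.Dart), a.fst = x → b.fst = y →
      E.rightFace a ≠ E.outerFace → E.rightFace b ≠ E.outerFace →
      (P (E.rightFace a) ↔ P (E.rightFace b)) from this _ _ p a b rfl rfl hf hg
  clear hf hg p a b
  intro x y p
  induction p with
  | nil => exact fun a b ha hb => E.iff_of_inner_at hG hE (ha.trans hb.symm) fun d _ => hP d
  | @cons x z y hxz p ih =>
    intro a b ha hb hao hbo
    -- Some inner face lies on the edge `xz`; it has a corner at `x` and one at `z`.
    by_cases h : E.rightFace ⟨(x, z), hxz⟩ = E.outerFace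
    · have h1 : E.rightFace (Dart.symm ⟨(x, z), hxz⟩) ≠ E.outerFace :=
        fun h' => E.rightFace_symm_ne hG _ (h'.trans h.symm)
      have h2 := E.rightFace_rot ⟨(x, z), hxz⟩
      refine (E.iff_of_inner_at hG hE (ha.trans (E.rot_fst ⟨(x, z), hxz⟩).symm)
        (fun d _ => hP d) hao (by rwa [h2])).trans ?_
      rw [h2]
      exact ih _ b rfl hb h1 hbo
    · refine (E.iff_of_inner_at hG hE ha (fun d _ => hP d) hao h).trans ?_
      rw [← E.rightFace_facePerm] at h ⊢
      exact ih _ b (E.facePerm_fst _) hb h hbo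

end PlaneEmbedding

/-! ### Perfect matchings and closed sets of inner faces -/

/-- A set is closed under the predecessors of a relation `r` if it contains `f` whenever it
contains `g` and `r f g` holds; these are the order ideals of the preorder generated by `r`. -/
def PredClosed {α : Type*} (r : α → α → Prop) (s : Set α) : Prop :=
  ∀ f g, r f g → g ∈ s → f ∈ s

/-- Two sets differ in the element `f` and in no other element. -/
def DiffersAt {α : Type*} (s t : Set α) (f : α) : Prop :=
  ∀ g, (g ∈ s ↔ g ∈ t) ↔ g ≠ f

/-- The undirected Hasse diagram of the lattice of order ideals: two ideals are adjacent when they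
differ in exactly one element. -/
def idealGraph {α : Type*} (r : α → α → Prop) : SimpleGraph {s : Set α // PredClosed r s} where
  Adj s t := ∃ f, DiffersAt s.1 t.1 f
  symm := ⟨fun s t ⟨f, h⟩ => ⟨f, fun g => by rw [← h g, iff_comm (a := g ∈ t.1)]⟩⟩
  loopless := ⟨fun s ⟨f, h⟩ => (h f).1 Iff.rfl rfl⟩

namespace SimpleGraph

variable {V : Type u} {G : SimpleGraph V}

theorem isPerfectMatching_iff_dart {M : G.Subgraph} :
    M.IsPerfectMatching ↔ ∀ v, ∃! d : G.Dart, d.fst = v ∧ M.Adj d.fst d.snd := by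
  rw [Subgraph.isPerfectMatching_iff]
  refine forall_congr' fun v => ⟨?_, ?_⟩
  · rintro ⟨w, hw, huniq⟩
    refine ⟨⟨(v, w), hw.adj_sub⟩, ⟨rfl, hw⟩, ?_⟩
    rintro ⟨⟨a, b⟩, hab⟩ ⟨h1, h2⟩
    obtain rfl : a = v := h1
    obtain rfl := huniq b h2
    rfl
  · rintro ⟨d, ⟨rfl, hd⟩, huniq⟩
    refine ⟨d.snd, hd, fun y hy => ?_⟩
    rw [← huniq ⟨(d.fst, y), hy.adj_sub⟩ ⟨rfl, hy⟩]

/-- Summing over the darts of a perfect matching amounts to summing over their sources. -/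
theorem sum_matching [Fintype V] [Fintype G.Dart] {M : G.Subgraph} (hM : M.IsPerfectMatching)
    (F : V → ℚ) :
    ∑ d : G.Dart, (open Classical in if M.Adj d.fst d.snd then F d.fst else 0) = ∑ v, F v := by
  classical
  choose m hm hu using isPerfectMatching_iff_dart.1 hM
  rw [← Finset.sum_filter]
  refine Finset.sum_bij' (fun d _ => d.fst) (fun v _ => m v) (by simp) ?_ ?_ ?_ (by simp)
  · intro v _
    simpa using (hm v).2
  · intro d hd
    exact (hu d.fst d ⟨rfl, (Finset.mem_filter.1 hd).2⟩).symm
  · intro v _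
    exact (hm v).1

end SimpleGraph

namespace PlaneEmbedding

variable {V : Type u} {G : SimpleGraph V} (E : PlaneEmbedding G)

theorem mem_faceEdges_iff {d : G.Dart} {f : E.Face} :
    d.edge ∈ E.faceEdges f ↔ E.rightFace d = f ∨ E.rightFace d.symm = f := by
  constructor
  · rintro ⟨a, ha, rfl⟩
    rcases (dart_edge_eq_iff _ _).1 ha with rfl | rfl
    · exact Or.inl rfl
    · exact Or.inr rfl
  · rintro (h | h)
    · exact ⟨d, rfl, h⟩
    · exact ⟨d.symm, d.edge_symm, h⟩

/-- The orientation of the inner dual given by a proper colouring: `f` precedes `g` if some edge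
has `f` on the right-hand side and `g` on the left-hand side when it is traversed from its vertex
of colour `true`. -/
def precedes (c : G.Coloring Bool) (f g : E.InnerFace) : Prop :=
  ∃ d : G.Dart, c d.fst = true ∧ E.rightFace d = f.1 ∧ E.rightFace d.symm = g.1

/-- The darts of the perfect matching encoded by a set `X` of inner faces: a dart leaving a vertex
of colour `true` belongs to it if its right-hand side is in `X` and its left-hand side is not,
where the outer face counts as an element of `X` on the right and as a non-element on the left. -/
def IsMatchDart (c : G.Coloring Bool) (X : Set E.Face) (d : G.Dart) : Prop :=
  (c d.fst = true ∧ (E.rightFace d = E.outerFace ∨ E.rightFace d ∈ X) ∧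
      E.rightFace d.symm ∉ X) ∨
    (c d.fst = false ∧ (E.rightFace d.symm = E.outerFace ∨ E.rightFace d.symm ∈ X) ∧
      E.rightFace d ∉ X)

/-- A set of inner faces that is closed under predecessors, as a set of faces. -/
structure IsIdeal (c : G.Coloring Bool) (X : Set E.Face) : Prop where
  outer_notMem : E.outerFace ∉ X
  closed : ∀ d : G.Dart, c d.fst = true → E.rightFace d ≠ E.outerFace →
    E.rightFace d.symm ∈ X → E.rightFace d ∈ X

/-- A set of inner faces, as a set of faces. -/
def faceSet (s : Set E.InnerFace) : Set E.Face :=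
  {f | ∃ h : f ≠ E.outerFace, (⟨f, h⟩ : E.InnerFace) ∈ s}

theorem mem_faceSet {s : Set E.InnerFace} {f : E.InnerFace} : f.1 ∈ E.faceSet s ↔ f ∈ s :=
  ⟨fun ⟨_, h⟩ => h, fun h => ⟨f.2, h⟩⟩

theorem isIdeal_faceSet {c : G.Coloring Bool} {s : Set E.InnerFace}
    (hs : PredClosed (E.precedes c) s) : E.IsIdeal c (E.faceSet s) := by
  refine ⟨fun h => h.choose rfl, ?_⟩
  rintro d hd hR ⟨hL, hg⟩
  exact ⟨hR, hs ⟨_, hR⟩ ⟨_, hL⟩ ⟨d, hd, rfl, rfl⟩ hg⟩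

theorem isMatchDart_symm (c : G.Coloring Bool) (X : Set E.Face) (d : G.Dart) :
    E.IsMatchDart c X d.symm ↔ E.IsMatchDart c X d := by
  have h : c d.fst ≠ c d.snd := c.valid d.adj
  have h1 : c d.symm.fst = !c d.fst := (Bool.eq_not_of_ne h.symm)
  rw [IsMatchDart, IsMatchDart, Dart.symm_symm, h1]
  cases c d.fst <;> simp

/-- The subgraph encoded by a set of faces. -/
def matchingOf (c : G.Coloring Bool) (X : Set E.Face) : G.Subgraph where
  verts := Set.univ
  Adj x y := ∃ h : G.Adj x y, E.IsMatchDart c X ⟨(x, y), h⟩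
  adj_sub := fun ⟨h, _⟩ => h
  edge_vert := fun _ => Set.mem_univ _
  symm := ⟨fun x y ⟨h, h'⟩ => ⟨h.symm, (E.isMatchDart_symm c X ⟨(x, y), h⟩).2 h'⟩⟩

theorem matchingOf_adj (c : G.Coloring Bool) (X : Set E.Face) (d : G.Dart) :
    (E.matchingOf c X).Adj d.fst d.snd ↔ E.IsMatchDart c X d :=
  ⟨fun ⟨_, h⟩ => h, fun h => ⟨d.adj, h⟩⟩

open Classical in
/-- The value `1` for a true proposition and `0` for a false one. -/
noncomputable def indicator (P : Prop) : ℚ := if P then 1 else 0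

theorem indicator_pos {P : Prop} (h : P) : indicator P = 1 := if_pos h

theorem indicator_neg {P : Prop} (h : ¬P) : indicator P = 0 := if_neg h

theorem indicator_nonneg (P : Prop) : 0 ≤ indicator P := by
  unfold indicator
  split_ifs <;> norm_num

theorem indicator_inj {P Q : Prop} : indicator P = indicator Q ↔ (P ↔ Q) := by
  by_cases hP : P <;> by_cases hQ : Q <;> simp [indicator, hP, hQ]

theorem indicator_isMatchDart_true {c : G.Coloring Bool} {X : Set E.Face} (hX : E.IsIdeal c X)
    {d : G.Dart} (hd : c d.fst = true) : indicator (E.IsMatchDart c X d) =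
      indicator (E.rightFace d ∈ X) + indicator (E.rightFace d = E.outerFace)
        - indicator (E.rightFace d.symm ∈ X) := by
  have h1 := hX.closed d hd
  by_cases h2 : E.rightFace d = E.outerFace
  · by_cases h3 : E.rightFace d.symm ∈ X <;>
      simp [indicator, IsMatchDart, hd, h2, h3, hX.outer_notMem]
  · by_cases h3 : E.rightFace d.symm ∈ X
    · simp [indicator, IsMatchDart, hd, h2, h3, h1 h2 h3]
    · by_cases h4 : E.rightFace d ∈ X <;> simp [indicator, IsMatchDart, hd, h2, h3, h4]

theorem indicator_isMatchDart_false {c : G.Coloring Bool} {X : Set E.Face} (hX : E.IsIdeal c X)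
    {d : G.Dart} (hd : c d.fst = false) : indicator (E.IsMatchDart c X d) =
      indicator (E.rightFace d.symm ∈ X) + indicator (E.rightFace d.symm = E.outerFace)
        - indicator (E.rightFace d ∈ X) := by
  have h : c d.snd ≠ c d.fst := (c.valid d.adj).symm
  have h1 : c d.symm.fst = true := by
    rw [hd] at h
    exact Bool.eq_true_of_not_eq_false h
  rw [← E.isMatchDart_symm, E.indicator_isMatchDart_true hX h1, Dart.symm_symm]

/-- Two encoded matchings agree on an edge if and only if the sets encoding them differ in the
same way on both sides of that edge. -/
theorem isMatchDart_iff_isMatchDart {c : G.Coloring Bool} {X Y : Set E.Face}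
    (hX : E.IsIdeal c X) (hY : E.IsIdeal c Y) (d : G.Dart) :
    (E.IsMatchDart c X d ↔ E.IsMatchDart c Y d) ↔
      indicator (E.rightFace d ∈ X) - indicator (E.rightFace d ∈ Y) =
        indicator (E.rightFace d.symm ∈ X) - indicator (E.rightFace d.symm ∈ Y) := by
  rw [← indicator_inj (P := E.IsMatchDart c X d)]
  cases hd : c d.fst
  · rw [E.indicator_isMatchDart_false hX hd, E.indicator_isMatchDart_false hY hd]
    constructor <;> intro h <;> linarith
  · rw [E.indicator_isMatchDart_true hX hd, E.indicator_isMatchDart_true hY hd]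
    constructor <;> intro h <;> linarith

theorem edgeSet_eq_iff {A B : Set (Sym2 V)} (hA : A ⊆ G.edgeSet) (hB : B ⊆ G.edgeSet) :
    A = B ↔ ∀ d : G.Dart, d.edge ∈ A ↔ d.edge ∈ B := by
  refine ⟨fun h d => by rw [h], fun h => Set.ext fun e => ?_⟩
  by_cases he : e ∈ G.edgeSet
  · induction e with
    | h x y => exact h ⟨(x, y), he⟩
  · exact iff_of_false (fun h => he (hA h)) (fun h => he (hB h))

theorem faceEdges_subset (f : E.Face) : E.faceEdges f ⊆ G.edgeSet := by
  rintro _ ⟨d, rfl, -⟩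
  exact d.edge_mem

theorem symmDiff_matchingOf_eq_iff {c : G.Coloring Bool} {X Y : Set E.Face}
    (hX : E.IsIdeal c X) (hY : E.IsIdeal c Y) (f : E.Face) :
    symmDiff (E.matchingOf c X).edgeSet (E.matchingOf c Y).edgeSet = E.faceEdges f ↔
      ∀ d : G.Dart, indicator (E.rightFace d ∈ X) - indicator (E.rightFace d ∈ Y) ≠
        indicator (E.rightFace d.symm ∈ X) - indicator (E.rightFace d.symm ∈ Y) ↔
          E.rightFace d = f ∨ E.rightFace d.symm = f := by
  rw [edgeSet_eq_iff (G := G) _ (E.faceEdges_subset f)]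
  · refine forall_congr' fun d => ?_
    have h1 : ∀ X, d.edge ∈ (E.matchingOf c X).edgeSet ↔ E.IsMatchDart c X d := fun X =>
      Subgraph.mem_edgeSet.trans (E.matchingOf_adj c X d)
    rw [E.mem_faceEdges_iff, Ne, ← E.isMatchDart_iff_isMatchDart hX hY, Set.mem_symmDiff, h1, h1]
    refine iff_congr ?_ Iff.rfl
    tauto
  · rintro e (⟨h, -⟩ | ⟨h, -⟩) <;> exact Subgraph.edgeSet_subset _ h

variable [Finite V]

theorem isPerfectMatching_matchingOf (hG : G.IsTwoConnected) (hE : E.IsOuterplane)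
    {c : G.Coloring Bool} {X : Set E.Face} (hX : E.IsIdeal c X) :
    (E.matchingOf c X).IsPerfectMatching := by
  classical
  have := Fintype.ofFinite G.Dart
  rw [isPerfectMatching_iff_dart]
  intro v
  obtain ⟨o, rfl, ho⟩ := hE.exists_dart v
  have hrot : ∀ F : G.Dart → ℚ, ∑ d : G.Dart with d.fst = o.fst, F (E.rot d)
      = ∑ d : G.Dart with d.fst = o.fst, F d := fun F =>
    Finset.sum_equiv E.rot (by simp [E.rot_fst]) (by simp)
  have hout : ∑ d : G.Dart with d.fst = o.fst, indicator (E.rightFace d = E.outerFace) = 1 := by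
    rw [Finset.sum_eq_single_of_mem o (by simp), indicator_pos ho]
    intro d hd hne
    exact indicator_neg fun h => hne (E.rightFace_injective_at hG (Finset.mem_filter.1 hd).2
      (h.trans ho.symm))
  -- The indicators of the faces cancel around `v`, and the outer corner contributes `1`.
  have hsum : ∑ d : G.Dart with d.fst = o.fst, indicator (E.IsMatchDart c X d) = 1 := by
    have h1 := hrot fun d => indicator (E.rightFace d ∈ X)
    have h2 := hrot fun d => indicator (E.rightFace d = E.outerFace)
    simp only [E.rightFace_rot] at h1 h2
    cases hc : c o.fst
    · rw [Finset.sum_congr rfl fun d hd => E.indicator_isMatchDart_false hX (d := d)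
        (by rw [(Finset.mem_filter.1 hd).2, hc]), Finset.sum_sub_distrib,
        Finset.sum_add_distrib, h1, h2, hout]
      ring
    · rw [Finset.sum_congr rfl fun d hd => E.indicator_isMatchDart_true hX (d := d)
        (by rw [(Finset.mem_filter.1 hd).2, hc]), Finset.sum_sub_distrib,
        Finset.sum_add_distrib, h1, hout]
      ring
  simp only [indicator, Finset.sum_boole, Finset.filter_filter] at hsum
  obtain ⟨m, hm⟩ := Finset.card_eq_one.1 (by exact_mod_cast hsum)
  have hm' : ∀ d : G.Dart, (d.fst = o.fst ∧ E.IsMatchDart c X d) ↔ d = m := fun d => by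
    simpa using Finset.ext_iff.1 hm d
  refine ⟨m, ?_, fun d hd => ?_⟩
  · change _ ∧ _
    rw [E.matchingOf_adj]
    exact (hm' m).2 rfl
  · replace hd : _ ∧ _ := hd
    rw [E.matchingOf_adj] at hd
    exact (hm' d).1 hd

theorem matchingOf_injective {c : G.Coloring Bool} {X Y : Set E.Face} (hX : E.IsIdeal c X)
    (hY : E.IsIdeal c Y) (h : E.matchingOf c X = E.matchingOf c Y) : X = Y := by
  have h1 := E.potential_const
    (h := fun f => indicator (f ∈ X) - indicator (f ∈ Y)) (fun d => by
      rw [← E.isMatchDart_iff_isMatchDart hX hY, ← matchingOf_adj, ← matchingOf_adj, h])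
  ext f
  have h2 := h1 f E.outerFace
  simp only [indicator_neg hX.outer_notMem, indicator_neg hY.outer_notMem, sub_self] at h2
  exact indicator_inj.1 (sub_eq_zero.1 h2)

/-- A function on the faces that vanishes on the outer face and changes exactly across the edges
of one inner face is supported on that face. -/
theorem changes_iff_eq_zero_iff (hG : G.IsTwoConnected) (hE : E.IsOuterplane) {δ : E.Face → ℚ}
    (hout : δ E.outerFace = 0) {f : E.Face} (hf : f ≠ E.outerFace) :
    (∀ d : G.Dart, δ (E.rightFace d) ≠ δ (E.rightFace d.symm) ↔
      E.rightFace d = f ∨ E.rightFace d.symm = f) ↔ ∀ g, δ g = 0 ↔ g ≠ f := by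
  constructor
  · intro h
    have hne : ∀ g, g ≠ f → δ g = 0 := by
      intro g hg
      obtain ⟨d, rfl⟩ := E.exists_rightFace g
      obtain ⟨o, ho, hoo⟩ := hE.exists_dart d.fst
      have hstep : ∀ a : G.Dart, E.rightFace a ≠ f → E.rightFace (E.rot a) ≠ f →
          δ (E.rightFace (E.rot a)) = δ (E.rightFace a) := by
        intro a h1 h2
        rw [E.rightFace_rot] at h2 ⊢
        by_contra h3
        exact ((h a).1 (Ne.symm h3)).elim h1 h2
      by_cases hfd : ∃ e : G.Dart, e.fst = d.fst ∧ E.rightFace e = f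
      · obtain ⟨e, he, hef⟩ := hfd
        have hkey : ∀ a : G.Dart, a.fst = e.fst → a ≠ e → E.rightFace a ≠ f :=
          fun a h1 h2 h3 => h2 (E.rightFace_injective_at hG h1 (h3.trans hef.symm))
        have h1 := E.iff_of_rot_iff (P := fun a => δ (E.rightFace a) = 0) (d₀ := e) (d := d)
          (d' := o) (fun a h1 h2 h3 => by
            rw [hstep a (hkey a h1 h2) (hkey _ ((E.rot_fst a).trans h1) h3)])
          he.symm (ho.trans he.symm) (fun h => hg (h ▸ hef))
          (fun h => hf (by rw [← hef, ← h, hoo]))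
        exact h1.2 (by rw [hoo]; exact hout)
      · push Not at hfd
        exact E.of_rot_closed (P := fun a => δ (E.rightFace a) = 0) (d := o) (d' := d)
          (fun a h1 h2 => by
            rw [hstep a (hfd a (h1.trans ho)) (hfd _ ((E.rot_fst a).trans (h1.trans ho))), h2])
          ho (by rw [hoo]; exact hout)
    refine fun g => ⟨?_, hne g⟩
    rintro h1 rfl
    obtain ⟨d, rfl⟩ := E.exists_rightFace g
    refine (h d).2 (Or.inl rfl) ?_
    rw [h1, hne _ (E.rightFace_symm_ne hG d)]
  · intro h d
    have h1 := E.rightFace_symm_ne hG d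
    by_cases h2 : E.rightFace d = f
    · have h3 : δ (E.rightFace d) ≠ 0 := fun h4 => (h _).1 h4 h2
      rw [(h (E.rightFace d.symm)).2 (fun h4 => h1 (h4.trans h2.symm))]
      simp [h2, h2 ▸ h3]
    · rw [(h (E.rightFace d)).2 h2, ne_comm, Ne, h]
      simp [h2]

/-- Two encoded matchings differ by the boundary of a face if and only if the sets encoding them
differ in that face alone. -/
theorem symmDiff_matchingOf_iff (hG : G.IsTwoConnected) (hE : E.IsOuterplane)
    {c : G.Coloring Bool} {X Y : Set E.Face} (hX : E.IsIdeal c X) (hY : E.IsIdeal c Y)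
    {f : E.Face} (hf : f ≠ E.outerFace) :
    symmDiff (E.matchingOf c X).edgeSet (E.matchingOf c Y).edgeSet = E.faceEdges f ↔
      ∀ g, (g ∈ X ↔ g ∈ Y) ↔ g ≠ f := by
  rw [E.symmDiff_matchingOf_eq_iff hX hY, E.changes_iff_eq_zero_iff hG hE
    (δ := fun g => indicator (g ∈ X) - indicator (g ∈ Y)) _ hf]
  · refine forall_congr' fun g => iff_congr ?_ Iff.rfl
    rw [sub_eq_zero, indicator_inj]
  · rw [indicator_neg hX.outer_notMem, indicator_neg hY.outer_notMem, sub_self]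

/-- Every perfect matching is encoded by a set of inner faces.  The difference with the matching
encoded by the empty set is a circulation, and its potential takes only the values `0` and `1` on
the faces. -/
theorem exists_matchingOf_eq (hG : G.IsTwoConnected) (hE : E.IsOuterplane)
    (c : G.Coloring Bool) {M : G.Subgraph} (hM : M.IsPerfectMatching) :
    ∃ X, E.IsIdeal c X ∧ E.matchingOf c X = M := by
  classical
  have := Fintype.ofFinite V
  have := Fintype.ofFinite G.Dart
  have h0 : E.IsIdeal c ∅ := ⟨id, fun _ _ _ h => h⟩
  have hN := E.isPerfectMatching_matchingOf hG hE h0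
  let sgn : V → ℚ := fun v => if c v = true then 1 else -1
  have hcol : ∀ d : G.Dart, c d.snd = !c d.fst :=
    fun d => Bool.eq_not_of_ne (c.valid d.adj).symm
  have hsgn : ∀ d : G.Dart, sgn d.snd = -sgn d.fst := fun d => by
    simp only [sgn, hcol d]
    cases c d.fst <;> simp
  have hflow : IsFlow fun d : G.Dart => sgn d.fst *
      (indicator (M.Adj d.fst d.snd) - indicator ((E.matchingOf c ∅).Adj d.fst d.snd)) := by
    refine ⟨fun d => ?_, fun p => ?_⟩
    · change sgn d.snd * (indicator (M.Adj d.snd d.fst) -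
        indicator ((E.matchingOf c ∅).Adj d.snd d.fst)) = _
      rw [hsgn, M.adj_comm d.snd, (E.matchingOf c ∅).adj_comm d.snd]
      ring
    · have h1 := (sum_matching hM fun v => sgn v * p v).trans
        (sum_matching hN fun v => sgn v * p v).symm
      rw [← sub_eq_zero, ← Finset.sum_sub_distrib] at h1
      rw [← h1]
      refine Finset.sum_congr rfl fun d _ => ?_
      by_cases h2 : M.Adj d.fst d.snd <;> by_cases h3 : (E.matchingOf c ∅).Adj d.fst d.snd <;>
        simp [indicator, h2, h3]
  obtain ⟨h', hh'⟩ := E.exists_potential hflow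
  obtain ⟨h, hh, ho⟩ : ∃ h : E.Face → ℚ, (∀ d : G.Dart, c d.fst = true →
      h (E.rightFace d) - h (E.rightFace d.symm) = indicator (M.Adj d.fst d.snd)
        - indicator (E.rightFace d = E.outerFace)) ∧ h E.outerFace = 0 := by
    refine ⟨fun f => h' f - h' E.outerFace, fun d hd => ?_, sub_self _⟩
    have h1 := hh' d
    have h2 : (E.matchingOf c ∅).Adj d.fst d.snd ↔ E.rightFace d = E.outerFace := by
      rw [E.matchingOf_adj, IsMatchDart]
      simp [hd]
    simp only [sgn, hd, if_true, one_mul, h2] at h1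
    rw [h1]
    ring
  have hval : ∀ d : G.Dart, c d.fst = true →
      h (E.rightFace d) = 0 ∨ h (E.rightFace d) = 1 := by
    intro d hd
    obtain ⟨o, hod, hoo⟩ := hE.exists_dart d.fst
    obtain ⟨m, ⟨hmd, hmM⟩, hmu⟩ := isPerfectMatching_iff_dart.1 hM d.fst
    have hstep : ∀ a : G.Dart, a.fst = d.fst → h (E.rightFace (E.rot a)) =
        h (E.rightFace a) + indicator (a = o) - indicator (a = m) := by
      intro a ha
      have h1 := hh a (by rw [ha, hd])
      have h2 : E.rightFace a = E.outerFace ↔ a = o :=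
        ⟨fun h => E.rightFace_injective_at hG (ha.trans hod.symm) (h.trans hoo.symm),
          fun h => h ▸ hoo⟩
      have h3 : M.Adj a.fst a.snd ↔ a = m :=
        ⟨fun h => hmu a ⟨ha, h⟩, fun h => h ▸ hmM⟩
      rw [h2, h3] at h1
      rw [E.rightFace_rot]
      linarith
    rw [← hoo] at ho
    by_cases hom : o = m
    · subst hom
      exact E.of_rot_closed (d := o) (d' := d)
        (P := fun a => h (E.rightFace a) = 0 ∨ h (E.rightFace a) = 1) (fun a ha hPa => by
        rw [hstep a (ha.trans hod), add_sub_cancel_right]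
        exact hPa) hod (Or.inl ho)
    · -- The potential rises by one at `o` and drops by one at `m`, where it must have been `1`.
      have hm1 : h (E.rightFace m) = 1 := by
        by_contra hm1
        by_cases hm0 : h (E.rightFace m) = 0
        · have h1 := E.of_rot_closed (d := E.rot m) (d' := m)
            (P := fun a => h (E.rightFace a) = -1) (fun a ha hPa => by
            rw [E.rot_fst] at ha
            have h2 : a ≠ o := by rintro rfl; rw [ho] at hPa; norm_num at hPa
            have h3 : a ≠ m := by rintro rfl; rw [hm0] at hPa; norm_num at hPa
            rw [hstep a (ha.trans hmd), indicator_neg h2, indicator_neg h3, hPa]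
            norm_num) (E.rot_fst m) (by
            rw [hstep m hmd, indicator_neg (Ne.symm hom), indicator_pos rfl, hm0]
            norm_num)
          rw [hm0] at h1
          norm_num at h1
        · have h1 := E.of_rot_closed (d := o) (d' := m)
            (P := fun a => h (E.rightFace a) = 0 ∨ h (E.rightFace a) = 1) (fun a ha hPa => by
            have h3 : a ≠ m := by rintro rfl; exact hPa.elim hm0 hm1
            rw [hstep a (ha.trans hod), indicator_neg h3, sub_zero]
            by_cases h2 : a = o
            · rw [indicator_pos h2, h2, ho]
              norm_num
            · rwa [indicator_neg h2, add_zero]) (hod.trans hmd.symm) (Or.inl ho)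
          exact h1.elim hm0 hm1
      exact E.of_rot_closed (d := o) (d' := d)
        (P := fun a => h (E.rightFace a) = 0 ∨ h (E.rightFace a) = 1) (fun a ha hPa => by
        rw [hstep a (ha.trans hod)]
        by_cases h2 : a = o
        · rw [indicator_pos h2, h2, indicator_neg hom, ho]
          norm_num
        · by_cases h3 : a = m
          · rw [indicator_pos h3, h3, indicator_neg (Ne.symm hom), hm1]
            norm_num
          · rwa [indicator_neg h2, indicator_neg h3, add_zero, sub_zero]) hod (Or.inl ho)
  have hval' : ∀ f, h f = 0 ∨ h f = 1 := by
    intro f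
    obtain ⟨d, rfl⟩ := E.exists_rightFace f
    cases hd : c d.fst
    · rw [← E.rightFace_facePerm]
      exact hval _ (by rw [E.facePerm_fst, hcol, hd]; rfl)
    · exact hval d hd
  have hX : E.IsIdeal c {f | h f = 1} := by
    refine ⟨fun h1 => ?_, fun d hd hR hL => ?_⟩
    · rw [Set.mem_ofPred_eq, ho] at h1
      norm_num at h1
    · have h1 := hh d hd
      rw [Set.mem_ofPred_eq] at hL ⊢
      rw [indicator_neg hR, hL] at h1
      refine (hval' _).resolve_left fun h2 => ?_
      rw [h2] at h1
      linarith [indicator_nonneg (M.Adj d.fst d.snd)]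
  refine ⟨_, hX, ?_⟩
  have hadj : ∀ d : G.Dart, c d.fst = true →
      ((E.matchingOf c {f | h f = 1}).Adj d.fst d.snd ↔ M.Adj d.fst d.snd) := by
    intro d hd
    have hi : ∀ f, indicator (f ∈ {f | h f = 1}) = h f := fun f => by
      rcases hval' f with h1 | h1
      · rw [h1, indicator_neg]
        rw [Set.mem_ofPred_eq, h1]
        norm_num
      · rw [indicator_pos (show f ∈ {f | h f = 1} from h1), h1]
    have h1 := E.indicator_isMatchDart_true hX hd
    rw [E.matchingOf_adj, ← indicator_inj (P := E.IsMatchDart _ _ _), h1, hi, hi]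
    linarith [hh d hd]
  refine Subgraph.ext ?_ ?_
  · exact (Set.eq_univ_of_forall hM.2).symm
  · funext x y
    refine propext ⟨fun hxy => ?_, fun hxy => ?_⟩
    · cases hx : c x
      · have h1 := hcol ⟨(x, y), hxy.adj_sub⟩
        exact ((hadj ⟨(y, x), hxy.adj_sub.symm⟩ (h1.trans (by simp [hx]))).1 hxy.symm).symm
      · exact (hadj ⟨(x, y), hxy.adj_sub⟩ hx).1 hxy
    · cases hx : c x
      · have h1 := hcol ⟨(x, y), hxy.adj_sub⟩
        exact ((hadj ⟨(y, x), hxy.adj_sub.symm⟩ (h1.trans (by simp [hx]))).2 hxy.symm).symm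
      · exact (hadj ⟨(x, y), hxy.adj_sub⟩ hx).2 hxy

/-- The resonance graph is the undirected Hasse diagram of the lattice of order ideals of the
oriented inner dual. -/
theorem nonempty_idealGraph_iso (hG : G.IsTwoConnected) (hE : E.IsOuterplane)
    (c : G.Coloring Bool) : Nonempty (idealGraph (E.precedes c) ≃g E.resonanceGraph) := by
  let F : {s : Set E.InnerFace // PredClosed (E.precedes c) s} →
      {M : G.Subgraph // M.IsPerfectMatching} := fun s =>
    ⟨E.matchingOf c (E.faceSet s.1),
      E.isPerfectMatching_matchingOf hG hE (E.isIdeal_faceSet s.2)⟩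
  have hF : Function.Bijective F := by
    refine ⟨fun s t h => ?_, fun M => ?_⟩
    · have h1 := E.matchingOf_injective (E.isIdeal_faceSet s.2) (E.isIdeal_faceSet t.2)
        (congrArg Subtype.val h)
      refine Subtype.ext (Set.ext fun g => ?_)
      rw [← E.mem_faceSet, h1, E.mem_faceSet]
    · obtain ⟨X, hX, hXM⟩ := E.exists_matchingOf_eq hG hE c M.2
      have h1 : E.faceSet {f : E.InnerFace | f.1 ∈ X} = X := by
        ext f
        exact ⟨fun ⟨_, hf⟩ => hf, fun hf => ⟨fun h => hX.outer_notMem (h ▸ hf), hf⟩⟩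
      refine ⟨⟨{f | f.1 ∈ X}, ?_⟩, Subtype.ext ((congrArg (E.matchingOf c) h1).trans hXM)⟩
      rintro f g ⟨d, hd, hf, hg⟩ hgX
      change f.1 ∈ X
      rw [← hf]
      exact hX.closed d hd (hf ▸ f.2) (hg ▸ hgX)
  refine ⟨⟨Equiv.ofBijective F hF, fun {s t} => exists_congr fun f => ?_⟩⟩
  refine (E.symmDiff_matchingOf_iff hG hE (E.isIdeal_faceSet s.2) (E.isIdeal_faceSet t.2)
    f.2).trans ⟨fun h g => ?_, fun h g => ?_⟩
  · rw [← E.mem_faceSet, ← E.mem_faceSet (s := t.1), h]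
    exact not_congr ⟨Subtype.ext, congrArg Subtype.val⟩
  · by_cases hg : g = E.outerFace
    · subst hg
      simp [(E.isIdeal_faceSet s.2).outer_notMem, (E.isIdeal_faceSet t.2).outer_notMem, f.2.symm]
    · have h1 := (iff_congr (iff_congr (E.mem_faceSet (f := ⟨g, hg⟩))
        (E.mem_faceSet (f := ⟨g, hg⟩))) Iff.rfl).2 (h ⟨g, hg⟩)
      exact h1.trans (not_congr ⟨congrArg Subtype.val, fun h2 => Subtype.ext h2⟩)

end PlaneEmbedding

/-! ### Reconstructing an oriented tree from its lattice of order ideals -/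

section IdealGraph

variable {α β : Type*}

/-- The combinatorial property of an oriented tree that is used below: removing any arrow `f → g`
leaves `f` and `g` in different components, that is, some set contains `f` but not `g` and no
other arrow enters or leaves it. -/
def ArrowsAreCuts (r : α → α → Prop) : Prop :=
  ∀ f g, r f g → ∃ S : Set α, f ∈ S ∧ g ∉ S ∧ ∀ a b, r a b → (a = f ∧ b = g) ∨ (a ∈ S ↔ b ∈ S)

/-- A relation is connected if every property that is not changed by its arrows is constant. -/
def ArrowConnected (r : α → α → Prop) : Prop :=
  ∀ P : α → Prop, (∀ f g, r f g → (P f ↔ P g)) → ∀ f g, P f ↔ P g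

open Relation

/-- A chain of arrows that leaves `S` must use the one arrow that does. -/
theorem ArrowsAreCuts.through {r : α → α → Prop} {f g : α} {S : Set α}
    (hS : ∀ a b, r a b → (a = f ∧ b = g) ∨ (a ∈ S ↔ b ∈ S)) {a b : α} (hab : ReflTransGen r a b)
    (ha : a ∈ S) (hb : b ∉ S) : ReflTransGen r a f ∧ ReflTransGen r g b := by
  induction hab with
  | refl => exact absurd ha hb
  | @tail b c hab hbc ih =>
    rcases hS b c hbc with ⟨rfl, rfl⟩ | h
    · exact ⟨hab, .refl⟩
    · obtain ⟨h1, h2⟩ := ih (fun h3 => hb (h.1 h3))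
      exact ⟨h1, h2.tail hbc⟩

theorem ArrowsAreCuts.acyclic {r : α → α → Prop} (hr : ArrowsAreCuts r) (a : α) :
    ¬TransGen r a a := by
  intro h
  obtain ⟨b, hab, hba⟩ := TransGen.head'_iff.1 h
  obtain ⟨S, ha, hb, hS⟩ := hr a b hab
  suffices ∀ c, ReflTransGen r b c → c ∉ S from this a hba ha
  intro c hc
  induction hc with
  | refl => exact hb
  | tail _ hcd ih =>
    rcases hS _ _ hcd with ⟨rfl, rfl⟩ | h
    · exact hb
    · exact fun h1 => ih (h.2 h1)

/-- The arrows are covering relations of the generated order. -/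
theorem ArrowsAreCuts.cover {r : α → α → Prop} (hr : ArrowsAreCuts r) {f g k : α} (hfg : r f g)
    (hfk : TransGen r f k) (hkg : TransGen r k g) : False := by
  obtain ⟨S, hf, hg, hS⟩ := hr f g hfg
  by_cases hk : k ∈ S
  · exact hr.acyclic f (hfk.trans_left (through hS hkg.to_reflTransGen hk hg).1)
  · exact hr.acyclic g (TransGen.trans_right (through hS hfk.to_reflTransGen hf hk).2 hkg)

theorem PredClosed.of_reflTransGen {r : α → α → Prop} {s : Set α} (hs : PredClosed r s) {a b : α}
    (h : ReflTransGen r a b) (hb : b ∈ s) : a ∈ s := by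
  induction h using ReflTransGen.head_induction_on with
  | refl => exact hb
  | head h _ ih => exact hs _ _ h ih

theorem predClosed_below (r : α → α → Prop) (a : α) : PredClosed r {b | ReflTransGen r b a} :=
  fun _ _ h h' => ReflTransGen.head h h'

theorem predClosed_strictBelow (r : α → α → Prop) (a : α) : PredClosed r {b | TransGen r b a} :=
  fun _ _ h h' => TransGen.head h h'

/-- A nonempty set has a maximal element with respect to an acyclic relation. -/
theorem exists_maximal_of_acyclic [Finite α] {r : α → α → Prop} (hr : ∀ a, ¬TransGen r a a)
    {s : Set α} (hs : s.Nonempty) : ∃ m ∈ s, ∀ a ∈ s, ¬r m a := by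
  have : IsTrans α (flip (TransGen r)) := ⟨fun a b c h1 h2 => TransGen.trans h2 h1⟩
  have : Std.Irrefl (flip (TransGen r)) := ⟨hr⟩
  obtain ⟨m, hm, h⟩ := (Finite.wellFounded_of_trans_of_irrefl (flip (TransGen r))).has_min s hs
  exact ⟨m, hm, fun a ha h1 => h a ha (TransGen.single h1)⟩

theorem PredClosed.diff_singleton {r : α → α → Prop} {s : Set α} (hs : PredClosed r s) {m : α}
    (hm : ∀ a ∈ s, ¬r m a) : PredClosed r (s \ {m}) := by
  rintro f g hfg ⟨hg, -⟩
  exact ⟨hs f g hfg hg, fun h => hm g hg (Set.mem_singleton_iff.1 h ▸ hfg)⟩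

variable {r : α → α → Prop} {r' : β → β → Prop}

theorem DiffersAt.symm {s t : Set α} {f : α} (h : DiffersAt s t f) : DiffersAt t s f :=
  fun g => by rw [← h g, iff_comm (a := g ∈ t)]

theorem DiffersAt.unique {s t : Set α} {f g : α} (h : DiffersAt s t f) (h' : DiffersAt s t g) :
    f = g := by
  by_contra hne
  exact (h f).1 ((h' f).2 hne) rfl

theorem differsAt_insert {s : Set α} {f : α} (hf : f ∉ s) : DiffersAt s (insert f s) f :=
  fun g => by by_cases hg : g = f <;> simp [hg, hf]

theorem DiffersAt.eq_insert {s t : Set α} {f : α} (h : DiffersAt s t f) (hf : f ∉ s) :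
    t = insert f s := by
  ext g
  have h1 := h g
  by_cases hg : g = f
  · subst hg
    simp only [Set.mem_insert, iff_true]
    tauto
  · rw [Set.mem_insert_iff, ← h1.2 hg]
    simp [hg]

/-- A graph isomorphism turns the step from `x` to `insert f x` into a change of the element
`l`. -/
def FlipsTo (φ : idealGraph r ≃g idealGraph r') (x : {s : Set α // PredClosed r s}) (f : α)
    (l : β) : Prop :=
  ∃ h : PredClosed r (insert f x.1), DiffersAt (φ x).1 (φ ⟨insert f x.1, h⟩).1 l

theorem exists_flipsTo (φ : idealGraph r ≃g idealGraph r') {x : {s : Set α // PredClosed r s}}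
    {f : α} (hf : f ∉ x.1) (h : PredClosed r (insert f x.1)) : ∃ l, FlipsTo φ x f l := by
  obtain ⟨l, hl⟩ := (φ.map_rel_iff (a := x) (b := ⟨insert f x.1, h⟩)).2 ⟨f, differsAt_insert hf⟩
  exact ⟨l, h, hl⟩

/-- Opposite edges of a square carry the same label. -/
theorem FlipsTo.of_insert {φ : idealGraph r ≃g idealGraph r'} {x : {s : Set α // PredClosed r s}}
    {f m : α} {l : β} (hm : m ∉ x.1) (hf : f ∉ x.1) (hfm : f ≠ m)
    (hxm : PredClosed r (insert m x.1)) (hxf : PredClosed r (insert f x.1))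
    (h : FlipsTo φ ⟨insert m x.1, hxm⟩ f l) : FlipsTo φ x f l := by
  obtain ⟨h1, hl⟩ := h
  obtain ⟨a, hxf', ha⟩ := exists_flipsTo φ hf hxf
  obtain ⟨b, hxm', hb⟩ := exists_flipsTo φ hm hxm
  obtain ⟨c, h2, hc⟩ := exists_flipsTo φ (x := ⟨insert f x.1, hxf⟩) (f := m)
    (by simp [hm, hfm.symm]) (by rw [Set.insert_comm]; exact h1)
  have h3 : (⟨insert m (insert f x.1), h2⟩ : {s : Set α // PredClosed r s})
      = ⟨insert f (insert m x.1), h1⟩ := Subtype.ext (Set.insert_comm _ _ _)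
  rw [h3] at hc
  -- Opposite corners of the square are distinct, so consecutive labels differ.
  have hne : ∀ y z : {s : Set α // PredClosed r s}, y ≠ z → ∃ g, ¬(g ∈ (φ y).1 ↔ g ∈ (φ z).1) := by
    intro y z hyz
    by_contra! h
    exact hyz (φ.injective (Subtype.ext (Set.ext h)))
  obtain ⟨g₁, hg₁⟩ := hne x ⟨insert f (insert m x.1), h1⟩ fun h =>
    hf ((congrArg Subtype.val h).symm ▸ Set.mem_insert _ _)
  obtain ⟨g₂, hg₂⟩ := hne ⟨insert f x.1, hxf⟩ ⟨insert m x.1, hxm⟩ fun h => by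
    have h4 : f ∈ insert m x.1 := Set.ext_iff.1 (congrArg Subtype.val h) f |>.1 (Set.mem_insert _ _)
    exact (Set.mem_insert_iff.1 h4).elim hfm hf
  have hal : a = l := by
    by_contra hal
    have e1 := ha a
    have e2 := hb a
    have e3 := hc a
    have e4 := hl a
    have k1 := ha g₁
    have k2 := hc g₁
    have k3 := ha g₂
    have k4 := hb g₂
    grind
  subst hal
  exact ⟨hxf', ha⟩

/-- Removing maximal elements one by one links the steps that add `f` to `x` and to a smaller
ideal `y` by a chain of squares. -/
theorem FlipsTo.of_subset [Finite α] (hr : ArrowsAreCuts r) {φ : idealGraph r ≃g idealGraph r'}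
    {x y : {s : Set α // PredClosed r s}} {f : α} {l : β} (hyx : y.1 ⊆ x.1) (hf : f ∉ x.1)
    (hy : PredClosed r (insert f y.1)) (h : FlipsTo φ x f l) : FlipsTo φ y f l := by
  induction hn : (x.1 \ y.1).ncard using Nat.strong_induction_on generalizing x with
  | _ n ih =>
    rcases (x.1 \ y.1).eq_empty_or_nonempty with h0 | h0
    · rwa [Subtype.ext (hyx.antisymm (Set.sdiff_eq_empty.1 h0))]
    · obtain ⟨m, ⟨hmx, hmy⟩, hm⟩ := exists_maximal_of_acyclic hr.acyclic h0
      have hmf : f ≠ m := fun h => hf (h ▸ hmx)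
      have hmax : ∀ a ∈ x.1, ¬r m a := fun a ha hma =>
        hm a ⟨ha, fun hay => hmy (y.2 m a hma hay)⟩ hma
      have hmaxf : ∀ a ∈ insert f x.1, ¬r m a := by
        rintro a (rfl | ha) hma
        · exact (Set.mem_insert_iff.1 (hy m a hma (Set.mem_insert _ _))).elim hmf.symm hmy
        · exact hmax a ha hma
      have hins : insert m (x.1 \ {m}) = x.1 := Set.insert_sdiff_self_of_mem hmx
      have hx' := x.2.diff_singleton hmax
      refine ih _ ?_ (x := ⟨x.1 \ {m}, hx'⟩)
        (fun a ha => ⟨hyx ha, fun h => hmy (Set.mem_singleton_iff.1 h ▸ ha)⟩)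
        (fun h => hf h.1) ?_ rfl
      · rw [← hn]
        refine Set.ncard_lt_ncard ⟨Set.sdiff_subset_sdiff_left Set.sdiff_subset, fun h1 => ?_⟩
        exact (h1 ⟨hmx, hmy⟩).1.2 rfl
      · refine FlipsTo.of_insert (m := m) (x := ⟨x.1 \ {m}, hx'⟩) (by simp) (fun h => hf h.1) hmf
          (by rw [hins]; exact x.2) ?_ ?_
        · rw [Set.insert_sdiff_singleton_comm hmf]
          exact h.choose.diff_singleton hmaxf
        · convert h

/-- The edges of the ideal graph that change `f` are all sent to edges that change one and the
same element. -/
theorem exists_label [Finite α] (hr : ArrowsAreCuts r) (φ : idealGraph r ≃g idealGraph r') :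
    ∃ L : α → β, ∀ (x y : {s : Set α // PredClosed r s}) (f : α), DiffersAt x.1 y.1 f →
      DiffersAt (φ x).1 (φ y).1 (L f) := by
  have h0 : ∀ f, PredClosed r (insert f {b | Relation.TransGen r b f}) := by
    rintro f a b hab (rfl | hb)
    · exact Or.inr (.single hab)
    · exact Or.inr (.head hab hb)
  choose L hL using fun f => exists_flipsTo φ (x := ⟨_, predClosed_strictBelow r f⟩)
    (hr.acyclic f) (h0 f)
  refine ⟨L, ?_⟩
  have key : ∀ (x y : {s : Set α // PredClosed r s}) (f : α), DiffersAt x.1 y.1 f → f ∉ x.1 →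
      DiffersAt (φ x).1 (φ y).1 (L f) := by
    intro x y f hxy hf
    have hy := hxy.eq_insert hf
    have hcl : PredClosed r (insert f x.1) := hy ▸ y.2
    obtain ⟨l, hl⟩ := exists_flipsTo φ hf hcl
    have hsub : {b | Relation.TransGen r b f} ⊆ x.1 := by
      intro b hb
      refine (Set.mem_insert_iff.1 (hcl.of_reflTransGen hb.to_reflTransGen
        (Set.mem_insert _ _))).resolve_left ?_
      rintro rfl
      exact hr.acyclic _ hb
    obtain ⟨h1, h2⟩ := hl.of_subset hr (y := ⟨_, predClosed_strictBelow r f⟩) hsub hf (h0 f)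
    obtain ⟨h3, h4⟩ := hL f
    rw [h4.unique h2]
    obtain ⟨h5, h6⟩ := hl
    rwa [show y = ⟨insert f x.1, h5⟩ from Subtype.ext hy]
  intro x y f hxy
  by_cases hf : f ∈ x.1
  · refine (key y x f hxy.symm fun hf' => ?_).symm
    exact (hxy f).1 (iff_of_true hf hf') rfl
  · exact key x y f hxy hf

theorem exists_differsAt (hr : ArrowsAreCuts r) (f : α) :
    ∃ x y : {s : Set α // PredClosed r s}, DiffersAt x.1 y.1 f := by
  refine ⟨⟨_, predClosed_strictBelow r f⟩, ⟨insert f {b | Relation.TransGen r b f}, ?_⟩,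
    differsAt_insert (hr.acyclic f)⟩
  rintro a b hab (rfl | hb)
  · exact Or.inr (.single hab)
  · exact Or.inr (.head hab hb)

theorem exists_label_equiv [Finite α] [Finite β] (hr : ArrowsAreCuts r) (hr' : ArrowsAreCuts r')
    (φ : idealGraph r ≃g idealGraph r') :
    ∃ L : α ≃ β, ∀ (x y : {s : Set α // PredClosed r s}) (f : α), DiffersAt x.1 y.1 f →
      DiffersAt (φ x).1 (φ y).1 (L f) := by
  obtain ⟨L, hL⟩ := exists_label hr φ
  obtain ⟨L', hL'⟩ := exists_label hr' φ.symm
  refine ⟨⟨L, L', fun f => ?_, fun f => ?_⟩, hL⟩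
  · obtain ⟨x, y, hxy⟩ := exists_differsAt hr f
    have h := hL' _ _ _ (hL _ _ _ hxy)
    rw [φ.symm_apply_apply, φ.symm_apply_apply] at h
    exact h.unique hxy
  · obtain ⟨x, y, hxy⟩ := exists_differsAt hr' f
    have h := hL _ _ _ (hL' _ _ _ hxy)
    rw [φ.apply_symm_apply, φ.apply_symm_apply] at h
    exact h.unique hxy

theorem predClosed_empty (r : α → α → Prop) : PredClosed r ∅ := fun _ _ _ h => h

theorem predClosed_univ (r : α → α → Prop) : PredClosed r Set.univ := fun _ _ _ _ => trivial

/-- Up to relabelling, an isomorphism of ideal graphs is the symmetric difference with the image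
of the empty ideal. -/
theorem mem_label_iff [Finite α] (hr : ArrowsAreCuts r) {φ : idealGraph r ≃g idealGraph r'}
    {L : α ≃ β} (hL : ∀ (x y : {s : Set α // PredClosed r s}) (f : α), DiffersAt x.1 y.1 f →
      DiffersAt (φ x).1 (φ y).1 (L f)) (x : {s : Set α // PredClosed r s}) (f : α) :
    (L f ∈ (φ x).1 ↔ L f ∈ (φ ⟨∅, predClosed_empty r⟩).1) ↔ f ∉ x.1 := by
  induction hn : x.1.ncard using Nat.strong_induction_on generalizing x with
  | _ n ih =>
    rcases x.1.eq_empty_or_nonempty with h0 | h0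
    · obtain rfl : x = ⟨∅, predClosed_empty r⟩ := Subtype.ext h0
      simp
    · obtain ⟨m, hmx, hm⟩ := exists_maximal_of_acyclic hr.acyclic h0
      have hx' := x.2.diff_singleton hm
      have h1 := ih _ (hn ▸ Set.ncard_sdiff_singleton_lt_of_mem hmx) ⟨x.1 \ {m}, hx'⟩ rfl
      have h2 := hL ⟨x.1 \ {m}, hx'⟩ x m (fun g => by
        by_cases hg : g = m <;> simp [hg, hmx]) (L f)
      rw [L.injective.ne_iff] at h2
      by_cases hfm : f = m
      · subst hfm
        have h3 : f ∉ x.1 \ {f} := by simp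
        tauto
      · have h3 : f ∈ x.1 \ {m} ↔ f ∈ x.1 := by simp [hfm]
        tauto

/-- An arrow forces its two ends to be comparable in the image, in a direction that depends on
whether they belong to the image of the empty ideal. -/
theorem comparable_of_arrow [Finite α] (hr : ArrowsAreCuts r) {φ : idealGraph r ≃g idealGraph r'}
    {L : α ≃ β} (hL : ∀ (x y : {s : Set α // PredClosed r s}) (f : α), DiffersAt x.1 y.1 f →
      DiffersAt (φ x).1 (φ y).1 (L f)) {f g : α} (hfg : r f g) :
    (L f ∉ (φ ⟨∅, predClosed_empty r⟩).1 ∧ L g ∉ (φ ⟨∅, predClosed_empty r⟩).1 ∧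
        ReflTransGen r' (L f) (L g)) ∨
      (L f ∈ (φ ⟨∅, predClosed_empty r⟩).1 ∧ L g ∈ (φ ⟨∅, predClosed_empty r⟩).1 ∧
        ReflTransGen r' (L g) (L f)) := by
  have key : ∀ x' : {s : Set β // PredClosed r' s},
      (¬(L g ∈ x'.1 ↔ L g ∈ (φ ⟨∅, predClosed_empty r⟩).1)) →
        ¬(L f ∈ x'.1 ↔ L f ∈ (φ ⟨∅, predClosed_empty r⟩).1) := by
    intro x' h1
    have h2 := mem_label_iff hr hL (φ.symm x')
    rw [φ.apply_symm_apply] at h2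
    rw [h2, not_not] at h1 ⊢
    exact (φ.symm x').2 f g hfg h1
  -- Test with the ideals that could separate the two elements.
  have h0 := key ⟨∅, predClosed_empty r'⟩
  have h1 := key ⟨Set.univ, predClosed_univ r'⟩
  have h2 := key ⟨_, predClosed_below r' (L f)⟩
  have h3 := key ⟨_, predClosed_below r' (L g)⟩
  simp only [Set.mem_empty_iff_false, false_iff, not_not, Set.mem_univ, true_iff,
    Set.mem_ofPred_eq, ReflTransGen.refl] at h0 h1 h2 h3
  tauto

/-- A bijection that respects the generated orders in both directions respects the arrows. -/
theorem arrow_of_comparable (hr : ArrowsAreCuts r) (hr' : ArrowsAreCuts r') (L : α ≃ β)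
    (h1 : ∀ f g, r f g → ReflTransGen r' (L f) (L g))
    (h2 : ∀ a b, r' a b → ReflTransGen r (L.symm a) (L.symm b)) {f g : α} (hfg : r f g) :
    r' (L f) (L g) := by
  have h2' : ∀ a b, ReflTransGen r' a b → a ≠ b → TransGen r (L.symm a) (L.symm b) := by
    intro a b hab hne
    have h : ReflTransGen r (L.symm a) (L.symm b) := by
      induction hab with
      | refl => exact .refl
      | @tail b c hab hbc ih =>
        by_cases hb : a = b
        · subst hb
          exact h2 _ _ hbc
        · exact (ih hb).trans (h2 _ _ hbc)
    exact (reflTransGen_iff_eq_or_transGen.1 h).resolve_left fun h => hne (L.symm.injective h).symm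
  obtain h | ⟨c, hfc, hcg⟩ := (h1 f g hfg).cases_head
  · rw [L.injective h] at hfg
    exact (hr.acyclic g (.single hfg)).elim
  · by_cases hc : c = L g
    · rwa [← hc]
    · have h3 := h2' _ _ (.single hfc) fun h => hr'.acyclic c (.single (by rwa [h] at hfc))
      have h4 := h2' _ _ hcg hc
      rw [L.symm_apply_apply] at h3 h4
      exact (hr.cover hfg h3 h4).elim

theorem ArrowsAreCuts.swap (hr : ArrowsAreCuts r) : ArrowsAreCuts (Function.swap r) := by
  intro f g hfg
  obtain ⟨S, hg, hf, hS⟩ := hr g f hfg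
  refine ⟨Sᶜ, hf, fun h => h hg, fun a b hab => ?_⟩
  rcases hS b a hab with ⟨rfl, rfl⟩ | h
  · exact Or.inl ⟨rfl, rfl⟩
  · exact Or.inr (not_congr h.symm)

/-- The undirected Hasse diagram of the lattice of order ideals determines an oriented tree up to
the reversal of all its arrows. -/
theorem exists_equiv_of_idealGraph_iso [Finite α] [Finite β] (hr : ArrowsAreCuts r)
    (hr' : ArrowsAreCuts r') (hconn : ArrowConnected r) (φ : idealGraph r ≃g idealGraph r') :
    ∃ L : α ≃ β, (∀ f g, r f g ↔ r' (L f) (L g)) ∨ (∀ f g, r f g ↔ r' (L g) (L f)) := by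
  obtain ⟨L, hL⟩ := exists_label_equiv hr hr' φ
  have hLs : ∀ (x y : {s : Set β // PredClosed r' s}) (f : β), DiffersAt x.1 y.1 f →
      DiffersAt (φ.symm x).1 (φ.symm y).1 (L.symm f) := by
    intro x y f hxy
    obtain ⟨l, hl⟩ := (φ.symm.map_rel_iff (a := x) (b := y)).2 ⟨f, hxy⟩
    have h := hL _ _ _ hl
    rw [φ.apply_symm_apply, φ.apply_symm_apply] at h
    rwa [hxy.unique h, L.symm_apply_apply]
  refine ⟨L, ?_⟩
  have hcomp := fun f g => comparable_of_arrow hr hL (f := f) (g := g)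
  have hcomp' := fun f g => comparable_of_arrow hr' hLs (f := f) (g := g)
  have hmem := mem_label_iff hr hL (φ.symm ⟨∅, predClosed_empty r'⟩)
  rw [φ.apply_symm_apply] at hmem
  simp only [Set.mem_empty_iff_false, false_iff] at hmem
  have hconst := hconn (fun f => L f ∈ (φ ⟨∅, predClosed_empty r⟩).1) fun f g hfg => by
    rcases hcomp f g hfg with ⟨h1, h2, -⟩ | ⟨h1, h2, -⟩
    · exact iff_of_false h1 h2
    · exact iff_of_true h1 h2
  by_cases hC : ∃ f, L f ∈ (φ ⟨∅, predClosed_empty r⟩).1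
  · obtain ⟨f₀, hf₀⟩ := hC
    have hall : ∀ f, L f ∈ (φ ⟨∅, predClosed_empty r⟩).1 := fun f => (hconst f₀ f).1 hf₀
    have h1 : ∀ f g, r f g → ReflTransGen (Function.swap r') (L f) (L g) := fun f g hfg => by
      rcases hcomp f g hfg with h | h
      · exact absurd (hall f) h.1
      · exact reflTransGen_swap.2 h.2.2
    have h2 : ∀ a b, Function.swap r' a b → ReflTransGen r (L.symm a) (L.symm b) :=
      fun a b hab => by
        rcases hcomp' b a hab with h | h
        · refine absurd (not_not.1 fun h3 => ?_) h.1
          exact (hmem _).2 h3 (hall _)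
        · exact h.2.2
    refine Or.inr fun f g => ⟨arrow_of_comparable hr hr'.swap L h1 h2, fun h => ?_⟩
    have h3 := arrow_of_comparable hr'.swap hr L.symm h2 (by simpa using h1) h
    simpa using h3
  · push Not at hC
    have h1 : ∀ f g, r f g → ReflTransGen r' (L f) (L g) := fun f g hfg => by
      rcases hcomp f g hfg with h | h
      · exact h.2.2
      · exact absurd h.1 (hC f)
    have h2 : ∀ a b, r' a b → ReflTransGen r (L.symm a) (L.symm b) := fun a b hab => by
      rcases hcomp' a b hab with h | h
      · exact h.2.2
      · exact absurd h.1 ((hmem _).1 (hC _))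
    refine Or.inl fun f g => ⟨arrow_of_comparable hr hr' L h1 h2, fun h => ?_⟩
    have h3 := arrow_of_comparable hr' hr L.symm h2 (by simpa using h1) h
    simpa using h3

/-- A bijection that respects the arrows induces an isomorphism of ideal graphs. -/
theorem nonempty_idealGraph_iso_of_equiv (L : α ≃ β) (hL : ∀ f g, r f g ↔ r' (L f) (L g)) :
    Nonempty (idealGraph r ≃g idealGraph r') := by
  have h1 : ∀ s, PredClosed r s ↔ PredClosed r' (L '' s) := by
    intro s
    constructor
    · rintro hs a b hab ⟨g, hg, rfl⟩
      exact ⟨L.symm a, hs _ g ((hL _ _).2 (by rwa [L.apply_symm_apply])) hg, L.apply_symm_apply a⟩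
    · intro hs f g hfg hg
      exact (L.injective.mem_set_image).1 (hs _ _ ((hL f g).1 hfg) (Set.mem_image_of_mem L hg))
  refine ⟨⟨(Equiv.Set.congr L).subtypeEquiv h1, fun {s t} => ?_⟩⟩
  change (∃ f, DiffersAt (L '' s.1) (L '' t.1) f) ↔ ∃ f, DiffersAt s.1 t.1 f
  rw [← L.exists_congr_right]
  refine exists_congr fun f => ?_
  rw [DiffersAt, ← L.forall_congr_right]
  simp only [L.injective.mem_set_image, L.injective.ne_iff]
  rfl

end IdealGraph

/-! ### The oriented inner dual, and the faces of a decomposition -/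

namespace PlaneEmbedding

variable {V : Type u} {G : SimpleGraph V} (E : PlaneEmbedding G)

theorem coloring_snd (c : G.Coloring Bool) (d : G.Dart) : c d.snd = !c d.fst :=
  Bool.eq_not_of_ne (c.valid d.adj).symm

theorem exists_dart_of_common_edge {f g : E.Face} (hfg : f ≠ g) {e : Sym2 V}
    (hf : e ∈ E.faceEdges f) (hg : e ∈ E.faceEdges g) :
    ∃ d : G.Dart, d.edge = e ∧ E.rightFace d = f ∧ E.rightFace d.symm = g := by
  obtain ⟨d, rfl, rfl⟩ := hf
  exact ⟨d, rfl, rfl, (E.mem_faceEdges_iff.1 hg).resolve_left hfg⟩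

theorem innerDual_adj_iff {f g : E.InnerFace} :
    E.innerDual.Adj f g ↔ f ≠ g ∧ ∃ d : G.Dart, E.rightFace d = f.1 ∧ E.rightFace d.symm = g.1 := by
  refine and_congr_right fun hfg => ⟨?_, ?_⟩
  · rintro ⟨e, hf, hg⟩
    obtain ⟨d, -, h⟩ := E.exists_dart_of_common_edge (fun h => hfg (Subtype.ext h)) hf hg
    exact ⟨d, h⟩
  · rintro ⟨d, hf, hg⟩
    exact ⟨d.edge, E.mem_faceEdges_iff.2 (Or.inl hf), E.mem_faceEdges_iff.2 (Or.inr hg)⟩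

theorem mem_periphery_edgeSet {f : E.Face} {e : Sym2 V} :
    e ∈ (E.periphery f).edgeSet ↔ e ∈ E.faceEdges f := by
  induction e with
  | h x y => exact Iff.rfl

/-- Reversing the colours reverses all arrows of the inner dual. -/
theorem precedes_swap {c c' : G.Coloring Bool} (h : ∀ v, c' v = !c v) (f g : E.InnerFace) :
    E.precedes c' f g ↔ E.precedes c g f := by
  have key : ∀ (c c' : G.Coloring Bool), (∀ v, c' v = !c v) → ∀ f g,
      E.precedes c f g → E.precedes c' g f := by
    rintro c c' h f g ⟨d, hd, hf, hg⟩
    refine ⟨d.symm, ?_, hg, by rwa [Dart.symm_symm]⟩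
    change c' d.snd = true
    rw [h, coloring_snd, hd]
    rfl
  exact ⟨key c' c (fun v => by rw [h, Bool.not_not]) f g, key c c' h g f⟩

theorem notMem_exterior {H : G.Subgraph} {f : E.Face} (hf : f ≠ E.outerFace)
    (h : E.faceEdges f ⊆ H.edgeSet) : f ∉ E.exterior H := by
  intro hext
  rcases Relation.ReflTransGen.cases_tail hext with h1 | ⟨g, -, d, hd, -, hg⟩
  · exact hf h1
  · exact hd (h (E.mem_faceEdges_iff.2 (Or.inr hg)))

theorem mem_exterior_of_step {H : G.Subgraph} {d : G.Dart} (h : d.edge ∉ H.edgeSet)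
    (hd : E.rightFace d ∈ E.exterior H) : E.rightFace d.symm ∈ E.exterior H :=
  Relation.ReflTransGen.tail hd ⟨d, h, rfl, rfl⟩

variable [Finite V]

theorem precedes_or_precedes_iff (hG : G.IsTwoConnected) (c : G.Coloring Bool)
    {f g : E.InnerFace} : E.precedes c f g ∨ E.precedes c g f ↔ E.innerDual.Adj f g := by
  have key : ∀ f g, E.precedes c f g → E.innerDual.Adj f g := by
    rintro f g ⟨d, -, hf, hg⟩
    refine E.innerDual_adj_iff.2 ⟨?_, d, hf, hg⟩
    rintro rfl
    exact E.rightFace_symm_ne hG d (hg.trans hf.symm)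
  refine ⟨fun h => h.elim (key f g) fun h => (key g f h).symm, fun h => ?_⟩
  obtain ⟨-, d, hf, hg⟩ := E.innerDual_adj_iff.1 h
  cases hd : c d.fst
  · refine Or.inr ⟨d.symm, ?_, hg, by rwa [Dart.symm_symm]⟩
    change c d.snd = true
    rw [coloring_snd, hd]
    rfl
  · exact Or.inl ⟨d, hd, hf, hg⟩

theorem arrowsAreCuts_precedes (hE : E.IsOuterplane) (c : G.Coloring Bool) :
    ArrowsAreCuts (E.precedes c) := by
  rintro f g ⟨d, hd, hf, hg⟩
  obtain ⟨S, h1, h2, hS⟩ := E.exists_cut hE (d := d) (hf ▸ f.2) (hg ▸ g.2)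
  refine ⟨{f | f.1 ∈ S}, show f.1 ∈ S from hf ▸ h1, fun h : g.1 ∈ S => h2 (hg ▸ h), ?_⟩
  rintro a b ⟨e, he, ha, hb⟩
  by_cases hed : e.edge = d.edge
  · rcases (dart_edge_eq_iff _ _).1 hed with rfl | rfl
    · exact Or.inl ⟨Subtype.ext (ha.symm.trans hf), Subtype.ext (hb.symm.trans hg)⟩
    · change c d.snd = true at he
      rw [coloring_snd, hd] at he
      exact absurd he (by decide)
  · have h := hS e (ha ▸ a.2) (hb ▸ b.2) hed
    rw [ha, hb] at h
    exact Or.inr h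

theorem arrowConnected_precedes (hG : G.IsTwoConnected) (hE : E.IsOuterplane)
    (c : G.Coloring Bool) : ArrowConnected (E.precedes c) := by
  intro P hP f g
  have h := E.inner_connected hG hE (P := fun f => ∃ h, P ⟨f, h⟩) (fun d hR hL => by
    suffices P ⟨_, hR⟩ ↔ P ⟨_, hL⟩ from
      ⟨fun ⟨_, h⟩ => ⟨hL, this.1 h⟩, fun ⟨_, h⟩ => ⟨hR, this.2 h⟩⟩
    cases hd : c d.fst
    · refine (hP ⟨_, hL⟩ ⟨_, hR⟩ ⟨d.symm, ?_, rfl, by rw [Dart.symm_symm]⟩).symm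
      change c d.snd = true
      rw [coloring_snd, hd]
      rfl
    · exact hP _ _ ⟨d, hd, rfl, rfl⟩) f.2 g.2
  exact ⟨fun hf => (h.1 ⟨f.2, hf⟩).2, fun hg => (h.2 ⟨g.2, hg⟩).2⟩

/-- Suppose that the faces of a sequence are distinct and that each of them, after the first, has
an edge in common with an earlier one.  The edge joining a face to an earlier one then separates
it from all the earlier ones. -/
theorem exists_cut_of_sequence (hE : E.IsOuterplane) {m : ℕ} {s : Fin (m + 1) → E.InnerFace}
    (hs : Function.Injective s)
    (hadj : ∀ i : Fin m, ∃ j ≤ i.castSucc, E.innerDual.Adj (s i.succ) (s j))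
    {i : Fin m} {j : Fin (m + 1)} (hj : j ≤ i.castSucc) {d : G.Dart}
    (hR : E.rightFace d = (s i.succ).1) (hL : E.rightFace d.symm = (s j).1) :
    ∃ S : Set E.Face, (s i.succ).1 ∈ S ∧ (∀ k ≤ i.castSucc, (s k).1 ∉ S) ∧
      ∀ a : G.Dart, E.rightFace a ≠ E.outerFace → E.rightFace a.symm ≠ E.outerFace →
        a.edge ≠ d.edge → (E.rightFace a ∈ S ↔ E.rightFace a.symm ∈ S) := by
  obtain ⟨S, hS, hS', hcut⟩ := E.exists_cut hE (d := d) (hR ▸ (s _).2) (hL ▸ (s _).2)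
  rw [hR] at hS
  rw [hL] at hS'
  have hconn : ∀ k : Fin (m + 1), k ≤ i.castSucc → ((s k).1 ∈ S ↔ (s 0).1 ∈ S) := by
    intro k
    induction k using WellFoundedLT.induction with
    | _ k ih =>
      intro hk
      cases k using Fin.cases with
      | zero => rfl
      | succ i' =>
        obtain ⟨j', hj', hadj'⟩ := hadj i'
        obtain ⟨-, e, heR, heL⟩ := E.innerDual_adj_iff.1 hadj'
        have hj'' : j' < i'.succ := Fin.le_castSucc_iff.1 hj'
        rw [← ih j' hj'' (hj''.le.trans hk), ← heR, ← heL]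
        refine hcut e (heR ▸ (s _).2) (heL ▸ (s _).2) fun hed => ?_
        -- The edge of `d` lies on `s i.succ`, while that of `e` lies on two earlier faces.
        have h1 : d.edge ∈ E.faceEdges (s i.succ).1 := E.mem_faceEdges_iff.2 (Or.inl hR)
        rw [← hed, E.mem_faceEdges_iff, heR, heL] at h1
        rcases h1 with h1 | h1
        · exact (Fin.le_castSucc_iff.1 hk).ne (hs (Subtype.ext h1))
        · exact (Fin.le_castSucc_iff.1 (hj''.le.trans hk)).ne (hs (Subtype.ext h1))
  exact ⟨S, hS, fun k hk h => hS' ((hconn j hj).2 ((hconn k hk).1 h)), hcut⟩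

theorem edge_eq_of_sequence (hE : E.IsOuterplane) {m : ℕ} {s : Fin (m + 1) → E.InnerFace}
    (hs : Function.Injective s)
    (hadj : ∀ i : Fin m, ∃ j ≤ i.castSucc, E.innerDual.Adj (s i.succ) (s j))
    {i : Fin m} {j k : Fin (m + 1)} (hj : j ≤ i.castSucc) (hk : k ≤ i.castSucc) {d a : G.Dart}
    (hR : E.rightFace d = (s i.succ).1) (hL : E.rightFace d.symm = (s j).1)
    (hR' : E.rightFace a = (s i.succ).1) (hL' : E.rightFace a.symm = (s k).1) :
    a.edge = d.edge := by
  obtain ⟨S, hS, hS', hcut⟩ := E.exists_cut_of_sequence hE hs hadj hj hR hL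
  by_contra hne
  have h1 := hcut a (hR' ▸ (s _).2) (hL' ▸ (s _).2) hne
  rw [hR', hL'] at h1
  exact hS' k hk (h1.1 hS)

end PlaneEmbedding

/-! ### Orientation of the inner dual from a decomposition -/

theorem SimpleGraph.Walk.exists_eq_cons_of_odd {V : Type u} {G : SimpleGraph V} {x y : V}
    (p : G.Walk x y) (hp : Odd p.length) :
    ∃ (z : V) (h : G.Adj x z) (q : G.Walk z y), p = Walk.cons h q := by
  cases p with
  | nil => exact absurd hp (by simp)
  | cons h q => exact ⟨_, h, q, rfl⟩

theorem SimpleGraph.Walk.IsTrail.eq_of_edges_eq {V : Type u} {G : SimpleGraph V} {x y : V}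
    {q : G.Walk x y} (hq : q.IsTrail) {e : Sym2 V} (he : e ∈ q.edges) (h : ∀ e' ∈ q.edges, e' = e) :
    e = s(x, y) := by
  cases q with
  | nil => exact absurd he List.not_mem_nil
  | cons h1 p =>
    cases p with
    | nil => exact (h _ (List.mem_cons_self)).symm
    | cons h2 p =>
      have h3 := hq.edges_nodup
      rw [Walk.edges_cons, Walk.edges_cons] at h3 h
      exact absurd ((h _ List.mem_cons_self).trans
        (h _ (List.mem_cons_of_mem _ List.mem_cons_self)).symm)
        (fun h4 => (List.nodup_cons.1 h3).1 (h4 ▸ List.mem_cons_self))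

namespace PlaneEmbedding.ReducibleFaceDecomposition

variable {V : Type u} {G : SimpleGraph V} {E : PlaneEmbedding G} {m : ℕ}
  (D : E.ReducibleFaceDecomposition m)

theorem sub_monotone : Monotone D.sub :=
  Fin.monotone_iff_le_succ.2 fun i => by
    rw [D.sub_succ]
    exact le_sup_left

theorem edgeSet_mono {j k : Fin (m + 1)} (h : j ≤ k) : (D.sub j).edgeSet ⊆ (D.sub k).edgeSet :=
  Subgraph.edgeSet_mono (D.sub_monotone h)

theorem mem_sub_succ {i : Fin m} {e : Sym2 V} :
    e ∈ (D.sub i.succ).edgeSet ↔ e ∈ (D.sub i.castSucc).edgeSet ∨ e ∈ (D.ear i).edges := by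
  rw [D.sub_succ, Subgraph.edgeSet_sup, Set.mem_union, Walk.mem_edges_toSubgraph]

theorem faceEdges_subset_sub (j : Fin (m + 1)) :
    E.faceEdges (D.face j).1 ⊆ (D.sub j).edgeSet := by
  intro e he
  cases j using Fin.cases with
  | zero =>
    rw [D.sub_zero]
    exact E.mem_periphery_edgeSet.2 he
  | succ i =>
    obtain ⟨q, -, hq, h⟩ := D.ear_surrounds i
    rw [h] at he
    exact D.mem_sub_succ.2 (he.symm.imp_left fun h => (hq e h).1)

theorem face_notMem_exterior {j k : Fin (m + 1)} (h : j ≤ k) :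
    (D.face j).1 ∉ E.exterior (D.sub k) :=
  E.notMem_exterior (D.face j).2 ((D.faceEdges_subset_sub j).trans (D.edgeSet_mono h))

theorem ear_not_nil (i : Fin m) : ∃ (z : V) (h : G.Adj (D.earStart i) z)
    (p : G.Walk z (D.earEnd i)), D.ear i = Walk.cons h p :=
  (D.ear i).exists_eq_cons_of_odd (D.ear_odd i)

theorem earStart_ne_earEnd (i : Fin m) : D.earStart i ≠ D.earEnd i := by
  obtain ⟨z, h, p, hp⟩ := D.ear_not_nil i
  have h1 := D.ear_isPath i
  rw [hp, Walk.cons_isPath_iff] at h1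
  exact fun h2 => h1.2 ((congrArg (· ∈ p.support) h2).mpr p.end_mem_support)

theorem mem_faceEdges_of_mem_ear {i : Fin m} {e : Sym2 V} (h : e ∈ (D.ear i).edges) :
    e ∈ E.faceEdges (D.face i.succ).1 := by
  obtain ⟨q, -, -, hq⟩ := D.ear_surrounds i
  rw [hq]
  exact Or.inl h

theorem notMem_sub_of_mem_ear {i : Fin m} {e : Sym2 V} (h : e ∈ (D.ear i).edges) :
    e ∉ (D.sub i.castSucc).edgeSet := by
  obtain ⟨d, hd, rfl⟩ := List.mem_map.1 h
  exact (D.ear_exterior i d hd).1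

theorem face_succ_mem_exterior (i : Fin m) :
    (D.face i.succ).1 ∈ E.exterior (D.sub i.castSucc) := by
  obtain ⟨z, h, p, hp⟩ := D.ear_not_nil i
  have hd : (⟨(D.earStart i, z), h⟩ : G.Dart) ∈ (D.ear i).darts := by simp [hp]
  have h1 := D.ear_exterior i _ hd
  have h2 := E.mem_faceEdges_iff.1 (D.mem_faceEdges_of_mem_ear (List.mem_map_of_mem hd))
  rcases h2 with h2 | h2
  · exact h2 ▸ h1.2
  · exact h2 ▸ E.mem_exterior_of_step h1.1 h1.2

theorem face_ne_of_lt {j k : Fin (m + 1)} (h : j < k) : D.face j ≠ D.face k := by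
  cases k using Fin.cases with
  | zero => exact absurd h (Fin.not_lt_zero j)
  | succ i =>
    intro h1
    exact D.face_notMem_exterior (Fin.le_castSucc_iff.2 h) (h1 ▸ D.face_succ_mem_exterior i)

theorem face_injective : Function.Injective D.face := by
  intro j k h
  rcases lt_trichotomy j k with h1 | h1 | h1
  · exact absurd h (D.face_ne_of_lt h1)
  · exact h1
  · exact absurd h.symm (D.face_ne_of_lt h1)

theorem face_surjective [Finite V] : Function.Surjective D.face := by
  classical
  have := Fintype.ofFinite E.InnerFace
  refine ((Fintype.bijective_iff_injective_and_card D.face).2 ⟨D.face_injective, ?_⟩).2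
  rw [← Nat.card_eq_fintype_card, ← Nat.card_eq_fintype_card, D.card_innerFace, Nat.card_fin]

theorem exists_face_of_mem_sub {k : Fin (m + 1)} {e : Sym2 V} (he : e ∈ (D.sub k).edgeSet) :
    ∃ j ≤ k, e ∈ E.faceEdges (D.face j).1 := by
  induction k using Fin.induction with
  | zero =>
    rw [D.sub_zero] at he
    exact ⟨0, le_rfl, E.mem_periphery_edgeSet.1 he⟩
  | succ i ih =>
    rcases D.mem_sub_succ.1 he with h | h
    · obtain ⟨j, hj, h1⟩ := ih h
      exact ⟨j, hj.trans (Fin.castSucc_lt_succ).le, h1⟩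
    · exact ⟨i.succ, le_rfl, D.mem_faceEdges_of_mem_ear h⟩

/-- The edges of the new face that do not belong to the ear separate it from earlier faces. -/
theorem exists_dart_of_mem_periphery {i : Fin m} {e : Sym2 V}
    (he : e ∈ E.faceEdges (D.face i.succ).1) (he' : e ∈ (D.sub i.castSucc).edgeSet) :
    ∃ j ≤ i.castSucc, ∃ d : G.Dart, d.edge = e ∧ E.rightFace d = (D.face i.succ).1 ∧
      E.rightFace d.symm = (D.face j).1 := by
  obtain ⟨j, hj, h⟩ := D.exists_face_of_mem_sub he'
  have hne : (D.face i.succ).1 ≠ (D.face j).1 := fun h1 =>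
    D.face_ne_of_lt (Fin.le_castSucc_iff.1 hj) (Subtype.ext h1.symm)
  exact ⟨j, hj, E.exists_dart_of_common_edge hne he h⟩

theorem exists_adj_earlier (i : Fin m) :
    ∃ j ≤ i.castSucc, E.innerDual.Adj (D.face i.succ) (D.face j) := by
  obtain ⟨q, -, hq, h⟩ := D.ear_surrounds i
  obtain ⟨e, he⟩ : ∃ e, e ∈ q.edges := by
    cases hq' : q.edges with
    | nil =>
      exact absurd (Walk.eq_of_length_eq_zero (by rw [← Walk.length_edges, hq']; rfl))
        (D.earStart_ne_earEnd i)
    | cons e l => exact ⟨e, List.mem_cons_self⟩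
  obtain ⟨j, hj, d, -, hd⟩ := D.exists_dart_of_mem_periphery (h ▸ Or.inr he) (hq e he).1
  exact ⟨j, hj, E.innerDual_adj_iff.2 ⟨fun h => D.face_ne_of_lt (Fin.le_castSucc_iff.1 hj) h.symm,
    d, hd⟩⟩

/-- In an outerplane graph the new face is glued along a single edge, and an ear that runs
clockwise starts where the dart along that edge with the new face on its right ends. -/
theorem dart_eq_of_clockwise [Finite V] (hG : G.IsTwoConnected) (hE : E.IsOuterplane) {i : Fin m}
    (hD : E.RunsClockwise (D.sub i.succ) (D.ear i)) {j : Fin (m + 1)} (hj : j ≤ i.castSucc)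
    {d : G.Dart} (hR : E.rightFace d = (D.face i.succ).1)
    (hL : E.rightFace d.symm = (D.face j).1) : d.fst = D.earEnd i ∧ d.snd = D.earStart i := by
  obtain ⟨q, hqp, hq, hface⟩ := D.ear_surrounds i
  have hdsub : d.edge ∈ (D.sub i.castSucc).edgeSet :=
    D.edgeSet_mono hj (D.faceEdges_subset_sub j (E.mem_faceEdges_iff.2 (Or.inr hL)))
  have hdq : d.edge ∈ q.edges := by
    have h1 : d.edge ∈ E.faceEdges (D.face i.succ).1 := E.mem_faceEdges_iff.2 (Or.inl hR)
    rw [hface] at h1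
    exact h1.resolve_left fun h => D.notMem_sub_of_mem_ear h hdsub
  have hedge : d.edge = s(D.earStart i, D.earEnd i) := by
    refine hqp.isTrail.eq_of_edges_eq hdq fun e he => ?_
    obtain ⟨k, hk, a, rfl, haR, haL⟩ :=
      D.exists_dart_of_mem_periphery (hface ▸ Or.inr he) (hq e he).1
    exact E.edge_eq_of_sequence hE D.face_injective D.exists_adj_earlier hj hk hR hL haR haL
  obtain ⟨z, hz, p, hp⟩ := D.ear_not_nil i
  have hmem : (⟨(D.earStart i, z), hz⟩ : G.Dart) ∈ (D.ear i).darts := by simp [hp]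
  -- The first dart of the ear has the new face on its right, so `d` cannot start there as well.
  have hfirst : E.rightFace ⟨(D.earStart i, z), hz⟩ = (D.face i.succ).1 :=
    (E.mem_faceEdges_iff.1 (D.mem_faceEdges_of_mem_ear (List.mem_map_of_mem hmem))).resolve_right
      fun h => D.face_notMem_exterior le_rfl (h ▸ (hD _ hmem).2)
  rcases Sym2.eq_iff.1 (show s(d.fst, d.snd) = _ from hedge) with ⟨h1, -⟩ | h
  · have h2 := E.rightFace_injective_at hG (a := d) (b := ⟨(D.earStart i, z), hz⟩) h1
      (hR.trans hfirst.symm)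
    exact absurd hdsub (h2 ▸ (D.ear_exterior i _ hmem).1)
  · exact h

end PlaneEmbedding.ReducibleFaceDecomposition

namespace PlaneEmbedding

variable {V V' : Type*} [Finite V] [Finite V'] {G : SimpleGraph V} {G' : SimpleGraph V'}
  {E : PlaneEmbedding G} {E' : PlaneEmbedding G'}

/-- Decompositions whose ears have matching colours identify the oriented inner duals. -/
theorem precedes_of_decompositions (hG : G.IsTwoConnected) (hE : E.IsOuterplane)
    (hG' : G'.IsTwoConnected) (hE' : E'.IsOuterplane) {m : ℕ}
    (D : E.ReducibleFaceDecomposition m) (D' : E'.ReducibleFaceDecomposition m)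
    (α : E.innerDual ≃g E'.innerDual) (hα : ∀ i, α (D.face i) = D'.face i)
    (hD : ∀ i, E.RunsClockwise (D.sub i.succ) (D.ear i))
    (hD' : ∀ i, E'.RunsClockwise (D'.sub i.succ) (D'.ear i))
    {c : G.Coloring Bool} {c' : G'.Coloring Bool}
    (hc : ∀ i, c (D.earStart i) = c' (D'.earStart i) ∧ c (D.earEnd i) = c' (D'.earEnd i))
    {f g : E.InnerFace} (hfg : E.precedes c f g) : E'.precedes c' (α f) (α g) := by
  have hadj := α.map_rel_iff.2 ((E.precedes_or_precedes_iff hG c).1 (Or.inl hfg))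
  obtain ⟨d, hd, hR, hL⟩ := hfg
  obtain ⟨-, d', hR', hL'⟩ := E'.innerDual_adj_iff.1 hadj
  refine ⟨d', ?_, hR', hL'⟩
  obtain ⟨a, rfl⟩ := D.face_surjective f
  obtain ⟨b, rfl⟩ := D.face_surjective g
  have hR' : E'.rightFace d' = (D'.face a).1 := hR'.trans (congrArg Subtype.val (hα a))
  have hL' : E'.rightFace d'.symm = (D'.face b).1 := hL'.trans (congrArg Subtype.val (hα b))
  rcases lt_trichotomy a b with h | rfl | h
  · cases b using Fin.cases with
    | zero => exact absurd h (Fin.not_lt_zero a)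
    | succ i =>
      have h1 := D.dart_eq_of_clockwise hG hE (hD i) (Fin.le_castSucc_iff.2 h) (d := d.symm) hL
        (by rwa [Dart.symm_symm])
      have h2 := D'.dart_eq_of_clockwise hG' hE' (hD' i) (Fin.le_castSucc_iff.2 h) (d := d'.symm)
        hL' (by rwa [Dart.symm_symm])
      have h3 : d.fst = D.earStart i := h1.2
      have h4 : d'.fst = D'.earStart i := h2.2
      rw [h4, ← (hc i).1, ← h3, hd]
  · exact absurd (hL.trans hR.symm) (E.rightFace_symm_ne hG d)
  · cases a using Fin.cases with
    | zero => exact absurd h (Fin.not_lt_zero b)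
    | succ i =>
      have h1 := D.dart_eq_of_clockwise hG hE (hD i) (Fin.le_castSucc_iff.2 h) hR hL
      have h2 := D'.dart_eq_of_clockwise hG' hE' (hD' i) (Fin.le_castSucc_iff.2 h) hR' hL'
      rw [h2.1, ← (hc i).2, ← h1.1, hd]

end PlaneEmbedding

/-! ### Decompositions along an enumeration of the faces -/

namespace PlaneEmbedding

variable {V : Type u} {G : SimpleGraph V} (E : PlaneEmbedding G)

/-- The path `p` runs along the face on the right-hand side of the dart `d`, from the end of `d` to
its source, and uses all the darts of that face except `d`. -/
def IsFacePath (d : G.Dart) (p : G.Walk d.snd d.fst) : Prop :=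
  p.IsPath ∧ ∀ a, a ∈ p.darts ↔ E.rightFace a = E.rightFace d ∧ a ≠ d

/-- The rest of the boundary of the face on the right of a dart is a path from the end of the dart
to its source. -/
theorem exists_face_path [Finite V] (hG : G.IsTwoConnected) (d : G.Dart) :
    ∃ p : G.Walk d.snd d.fst, E.IsFacePath d p := by
  classical
  obtain ⟨p₀, hp₀⟩ := E.exists_walk_of_rightFace_eq (E.rightFace_facePerm d)
  obtain ⟨p, hp, hface⟩ : ∃ p : G.Walk d.snd d.fst, p.IsPath ∧
      ∀ a ∈ p.darts, E.rightFace a = E.rightFace d := by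
    refine ⟨(p₀.copy (E.facePerm_fst d) rfl).bypass, Walk.bypass_isPath _, fun a ha => ?_⟩
    have h := Walk.darts_bypass_subset_darts _ ha
    rw [Walk.darts_copy] at h
    rw [hp₀ a h, E.rightFace_facePerm]
  have hsupp := p.map_fst_darts_append
  have hd : d ∉ p.darts := by
    intro h
    have h1 := hp.support_nodup
    rw [← hsupp, List.nodup_append] at h1
    exact h1.2.2 _ (List.mem_map_of_mem h) _ (List.mem_singleton.2 rfl) rfl
  have hnext : ∀ a : G.Dart, E.rightFace a = E.rightFace d → a.snd ∈ p.support →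
      E.facePerm a ∈ p.darts ∨ E.facePerm a = d := by
    intro a ha hs
    have h1 := (E.rightFace_facePerm a).trans ha
    rw [← hsupp, List.mem_append, List.mem_map, List.mem_singleton] at hs
    rcases hs with ⟨b, hb, hba⟩ | hs
    · left
      rwa [E.rightFace_injective_at hG (a := E.facePerm a) (b := b)
        ((E.facePerm_fst a).trans hba.symm) (h1.trans (hface b hb).symm)]
    · right
      exact E.rightFace_injective_at hG ((E.facePerm_fst a).trans hs) h1
  refine ⟨p, hp, fun a => ⟨fun h => ⟨hface a h, fun h' => hd (h' ▸ h)⟩, fun ⟨h, hne⟩ => ?_⟩⟩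
  have key : ∀ i : ℕ, (E.facePerm ^ i) d ∈ p.darts ∨ (E.facePerm ^ i) d = d := by
    intro i
    induction i with
    | zero => exact Or.inr rfl
    | succ n ih =>
      rw [pow_succ', Equiv.Perm.mul_apply]
      rcases ih with h | h
      · exact hnext _ (hface _ h) (p.dart_snd_mem_support_of_mem_darts h)
      · rw [h]
        exact hnext d rfl p.start_mem_support
  obtain ⟨i, rfl⟩ := (E.rightFace_eq_iff.1 h.symm).exists_nat_pow_eq
  exact (key i).resolve_right hne

variable {E}

theorem IsFacePath.mem_edges_iff [Finite V] (hG : G.IsTwoConnected) {d : G.Dart}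
    {p : G.Walk d.snd d.fst} (hp : E.IsFacePath d p) {e : Sym2 V} :
    e ∈ p.edges ↔ e ∈ E.faceEdges (E.rightFace d) ∧ e ≠ d.edge := by
  constructor
  · intro h
    obtain ⟨a, ha, rfl⟩ := List.mem_map.1 h
    obtain ⟨h1, h2⟩ := (hp.2 a).1 ha
    refine ⟨⟨a, rfl, h1⟩, fun h3 => ?_⟩
    rcases (dart_edge_eq_iff _ _).1 h3 with rfl | rfl
    · exact h2 rfl
    · exact E.rightFace_symm_ne hG d h1
  · rintro ⟨⟨a, rfl, ha⟩, hne⟩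
    exact List.mem_map_of_mem ((hp.2 a).2 ⟨ha, fun h => hne (by rw [h])⟩)

theorem IsFacePath.mem_support_iff {d : G.Dart} {p : G.Walk d.snd d.fst}
    (hp : E.IsFacePath d p) {v : V} :
    v ∈ p.support ↔ v ∈ (E.periphery (E.rightFace d)).verts := by
  rw [E.mem_periphery_verts_iff]
  constructor
  · intro h
    rw [← p.map_fst_darts_append, List.mem_append, List.mem_map, List.mem_singleton] at h
    rcases h with ⟨a, ha, hav⟩ | rfl
    · exact ⟨a, hav, ((hp.2 a).1 ha).1⟩
    · exact ⟨d, rfl, rfl⟩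
  · rintro ⟨a, rfl, ha⟩
    by_cases h : a = d
    · rw [h]
      exact p.end_mem_support
    · exact p.dart_fst_mem_support_of_mem_darts ((hp.2 a).2 ⟨ha, h⟩)

theorem odd_length_of_reverses (c : G.Coloring Bool) {d : G.Dart} (p : G.Walk d.snd d.fst) :
    Odd p.length := by
  rw [c.odd_length_iff_not_congr, coloring_snd]
  simp

/-- The boundary of a face is an edge together with a path joining its ends. -/
theorem periphery_eq_sup [Finite V] (hG : G.IsTwoConnected) {d : G.Dart}
    {p : G.Walk d.snd d.fst} (hp : E.IsFacePath d p) :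
    E.periphery (E.rightFace d) = G.subgraphOfAdj d.symm.adj ⊔ p.toSubgraph := by
  have hd : d.edge ∈ E.faceEdges (E.rightFace d) := ⟨d, rfl, rfl⟩
  refine Subgraph.ext ?_ ?_
  · ext v
    rw [Subgraph.verts_sup, Set.mem_union, Walk.mem_verts_toSubgraph, ← hp.mem_support_iff]
    refine ⟨Or.inr, fun h => h.elim ?_ id⟩
    rintro (rfl | rfl)
    · exact p.start_mem_support
    · exact p.end_mem_support
  · funext x y
    rw [Subgraph.sup_adj, Walk.adj_toSubgraph_iff_mem_edges, hp.mem_edges_iff hG]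
    have h1 : (G.subgraphOfAdj d.symm.adj).Adj x y ↔ s(x, y) = d.edge := by
      rw [← d.edge_symm, eq_comm]
      exact Iff.rfl
    have h2 : (E.periphery (E.rightFace d)).Adj x y ↔ s(x, y) ∈ E.faceEdges (E.rightFace d) :=
      Iff.rfl
    rw [h1, h2]
    refine propext ⟨fun h => or_iff_not_imp_left.2 fun h3 => ⟨h, h3⟩, ?_⟩
    rintro (h | h)
    · rwa [h]
    · exact h.1

/-- The union of the boundaries of the first faces of a sequence. -/
def unionUpTo (E : PlaneEmbedding G) {m : ℕ} (s : Fin (m + 1) → E.InnerFace) (k : Fin (m + 1)) :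
    G.Subgraph where
  verts := {v | ∃ j ≤ k, v ∈ (E.periphery (s j).1).verts}
  Adj x y := ∃ j ≤ k, (E.periphery (s j).1).Adj x y
  adj_sub := fun ⟨_, _, h⟩ => h.adj_sub
  edge_vert := fun ⟨j, hj, h⟩ => ⟨j, hj, (E.periphery _).edge_vert h⟩
  symm := ⟨fun _ _ ⟨j, hj, h⟩ => ⟨j, hj, h.symm⟩⟩

theorem mem_unionUpTo_edgeSet {m : ℕ} {s : Fin (m + 1) → E.InnerFace} {k : Fin (m + 1)}
    {e : Sym2 V} : e ∈ (E.unionUpTo s k).edgeSet ↔ ∃ j ≤ k, e ∈ E.faceEdges (s j).1 := by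
  induction e with
  | h x y => exact Iff.rfl

/-- An enumeration of the inner faces in which each face, after the first, has an edge in common
with an earlier one; `dart i` is the dart along that edge with the new face on its right. -/
structure GluingOrder (E : PlaneEmbedding G) (m : ℕ) where
  face : Fin (m + 1) → E.InnerFace
  bijective : Function.Bijective face
  prev : Fin m → Fin (m + 1)
  prev_le : ∀ i, prev i ≤ i.castSucc
  dart : Fin m → G.Dart
  rightFace_dart : ∀ i, E.rightFace (dart i) = (face i.succ).1
  leftFace_dart : ∀ i, E.rightFace (dart i).symm = (face (prev i)).1

namespace GluingOrder

variable {m : ℕ} (O : E.GluingOrder m)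

theorem face_val_inj {j k : Fin (m + 1)} : (O.face j).1 = (O.face k).1 ↔ j = k :=
  ⟨fun h => O.bijective.1 (Subtype.ext h), fun h => by rw [h]⟩

theorem exists_face {f : E.Face} (hf : f ≠ E.outerFace) : ∃ k, (O.face k).1 = f := by
  obtain ⟨k, hk⟩ := O.bijective.2 ⟨f, hf⟩
  exact ⟨k, congrArg Subtype.val hk⟩

theorem prev_ne (i : Fin m) : O.prev i ≠ i.succ :=
  (Fin.le_castSucc_iff.1 (O.prev_le i)).ne

theorem exists_adj (i : Fin m) :
    ∃ j ≤ i.castSucc, E.innerDual.Adj (O.face i.succ) (O.face j) :=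
  ⟨O.prev i, O.prev_le i, E.innerDual_adj_iff.2
    ⟨fun h => O.prev_ne i (O.bijective.1 h).symm, O.dart i, O.rightFace_dart i, O.leftFace_dart i⟩⟩

theorem eq_dart [Finite V] (hE : E.IsOuterplane) {i : Fin m} {k : Fin (m + 1)} (hk : k ≤ i.castSucc)
    {a : G.Dart} (hR : E.rightFace a = (O.face i.succ).1)
    (hL : E.rightFace a.symm = (O.face k).1) : a = O.dart i := by
  have h := E.edge_eq_of_sequence hE O.bijective.1 O.exists_adj (O.prev_le i) hk
    (O.rightFace_dart i) (O.leftFace_dart i) hR hL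
  refine ((dart_edge_eq_iff _ _).1 h).resolve_right fun h1 => O.prev_ne i ?_
  rw [← O.face_val_inj, ← O.leftFace_dart, ← h1, hR]

theorem edge_mem_unionUpTo_iff {k : Fin (m + 1)} {a : G.Dart} :
    a.edge ∈ (E.unionUpTo O.face k).edgeSet ↔
      ∃ j ≤ k, E.rightFace a = (O.face j).1 ∨ E.rightFace a.symm = (O.face j).1 := by
  simp only [mem_unionUpTo_edgeSet, E.mem_faceEdges_iff]

theorem outerFace_mem_exterior (H : G.Subgraph) : E.outerFace ∈ E.exterior H :=
  Relation.ReflTransGen.refl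

/-- A face lies in the exterior of the union of the faces that precede it: it has an edge other
than the one it shares with an earlier face, and crossing that edge leads to the outer face or to
a later face. -/
theorem mem_exterior [Finite V] (hG : G.IsTwoConnected) (hE : E.IsOuterplane) {j k : Fin (m + 1)}
    (hjk : j < k) : (O.face k).1 ∈ E.exterior (E.unionUpTo O.face j) := by
  induction k using WellFoundedGT.induction with
  | _ k ih =>
    cases k using Fin.cases with
    | zero => exact absurd hjk (Fin.not_lt_zero j)
    | succ i =>
      obtain ⟨a, hne, haR⟩ : ∃ a, a ≠ O.dart i ∧ E.rightFace a = (O.face i.succ).1 := by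
        refine ⟨E.facePerm (O.dart i), fun h => (O.dart i).adj.ne ?_,
          (E.rightFace_facePerm _).trans (O.rightFace_dart i)⟩
        rw [← E.facePerm_fst, h]
      have hstep : ∀ l, E.rightFace a.symm = l → l ∈ E.exterior (E.unionUpTo O.face j) →
          (∀ k ≤ j, l ≠ (O.face k).1) →
          (O.face i.succ).1 ∈ E.exterior (E.unionUpTo O.face j) := by
        rintro _ rfl hext hk
        have h := E.mem_exterior_of_step (H := E.unionUpTo O.face j) (d := a.symm) (by
          rw [Dart.edge_symm, O.edge_mem_unionUpTo_iff]
          rintro ⟨k, hkj, h | h⟩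
          · rw [haR, O.face_val_inj] at h
            exact (hkj.trans_lt hjk).ne h.symm
          · exact hk k hkj h) hext
        rwa [Dart.symm_symm, haR] at h
      by_cases hout : E.rightFace a.symm = E.outerFace
      · exact hstep _ hout (outerFace_mem_exterior _) fun k _ h => (O.face k).2 h.symm
      · obtain ⟨l, hl⟩ := O.exists_face hout
        have hil : i.succ < l := by
          refine lt_of_le_of_ne (not_lt.1 fun h => hne ?_) fun h => ?_
          · exact O.eq_dart hE (Fin.le_castSucc_iff.2 h) haR hl.symm
          · exact E.rightFace_symm_ne hG a (by rw [← hl, haR, h])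
        refine hstep _ hl.symm (ih l hil (hjk.trans hil)) fun k hk h => ?_
        rw [O.face_val_inj] at h
        exact ((hk.trans_lt hjk).trans hil).ne h.symm

theorem edge_notMem [Finite V] (hE : E.IsOuterplane) {i : Fin m} {a : G.Dart}
    (hR : E.rightFace a = (O.face i.succ).1) (hne : a ≠ O.dart i) :
    a.edge ∉ (E.unionUpTo O.face i.castSucc).edgeSet := by
  rw [O.edge_mem_unionUpTo_iff]
  rintro ⟨k, hk, h | h⟩
  · rw [hR, O.face_val_inj] at h
    exact (Fin.le_castSucc_iff.1 hk).ne h.symm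
  · exact hne (O.eq_dart hE hk hR h)

/-- Any vertex that a new face has in common with an earlier face is an end of the edge along
which the new face is glued. -/
theorem mem_gluing_edge [Finite V] (hG : G.IsTwoConnected) (hE : E.IsOuterplane) {i : Fin m} {v : V}
    (hv : v ∈ (E.periphery (O.face i.succ).1).verts)
    (hv' : v ∈ (E.unionUpTo O.face i.castSucc).verts) :
    v = (O.dart i).snd ∨ v = (O.dart i).fst := by
  obtain ⟨a, rfl, ha⟩ := E.mem_periphery_verts_iff.1 hv
  obtain ⟨k, hk, hv'⟩ := hv'
  obtain ⟨b, hb, hbk⟩ := E.mem_periphery_verts_iff.1 hv'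
  obtain ⟨S, hS, hS', hcut⟩ := E.exists_cut_of_sequence hE O.bijective.1 O.exists_adj (O.prev_le i)
    (O.rightFace_dart i) (O.leftFace_dart i)
  by_contra! hne
  have h := E.iff_of_inner_at hG hE (P := fun f => f ∈ S) hb.symm (fun d hd h1 h2 => by
    refine hcut d h1 h2 fun h3 => ?_
    rcases (dart_edge_eq_iff _ _).1 h3 with rfl | rfl
    · exact hne.2 hd.symm
    · exact hne.1 hd.symm) (ha ▸ (O.face _).2) (hbk ▸ (O.face _).2)
  rw [ha, hbk] at h
  exact hS' k hk (h.1 hS)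

theorem unionUpTo_last [Finite V] (hG : G.IsTwoConnected) (hE : E.IsOuterplane) :
    E.unionUpTo O.face (Fin.last m) = ⊤ := by
  have hface : ∀ f : E.Face, f ≠ E.outerFace → ∃ j ≤ Fin.last m, (O.face j).1 = f := fun f hf => by
    obtain ⟨k, hk⟩ := O.exists_face hf
    exact ⟨k, Fin.le_last k, hk⟩
  refine Subgraph.ext ?_ ?_
  · refine Set.eq_univ_of_forall fun v => ?_
    obtain ⟨o, rfl, ho⟩ := hE.exists_dart v
    obtain ⟨j, hj, hjf⟩ := hface (E.rightFace (E.rot o)) (by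
      rw [E.rightFace_rot, ← ho]
      exact E.rightFace_symm_ne hG o)
    exact ⟨j, hj, E.mem_periphery_verts_iff.2 ⟨E.rot o, E.rot_fst o, hjf.symm⟩⟩
  · funext x y
    refine propext ⟨fun h => h.choose_spec.2.adj_sub, fun h => ?_⟩
    obtain ⟨f, hf, hmem⟩ : ∃ f ≠ E.outerFace, s(x, y) ∈ E.faceEdges f := by
      by_cases h1 : E.rightFace ⟨(x, y), h⟩ = E.outerFace
      · refine ⟨_, fun h2 => E.rightFace_symm_ne hG ⟨(x, y), h⟩ (h2.trans h1.symm),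
          Dart.symm ⟨(x, y), h⟩, Dart.edge_symm _, rfl⟩
      · exact ⟨_, h1, _, rfl, rfl⟩
    obtain ⟨j, hj, rfl⟩ := hface f hf
    exact ⟨j, hj, hmem⟩

theorem unionUpTo_succ [Finite V] (hG : G.IsTwoConnected) (i : Fin m)
    {p : G.Walk (O.dart i).snd (O.dart i).fst} (hp : E.IsFacePath (O.dart i) p) :
    E.unionUpTo O.face i.succ = E.unionUpTo O.face i.castSucc ⊔ p.toSubgraph := by
  have hle : ∀ j, j ≤ i.succ ↔ j ≤ i.castSucc ∨ j = i.succ := fun j => by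
    rw [Fin.le_castSucc_iff, le_iff_lt_or_eq]
  refine Subgraph.ext ?_ ?_
  · ext v
    rw [Subgraph.verts_sup, Set.mem_union, Walk.mem_verts_toSubgraph, hp.mem_support_iff,
      O.rightFace_dart]
    constructor
    · rintro ⟨j, hj, hv⟩
      rcases (hle j).1 hj with h | rfl
      · exact Or.inl ⟨j, h, hv⟩
      · exact Or.inr hv
    · rintro (⟨j, hj, hv⟩ | hv)
      · exact ⟨j, (hle j).2 (Or.inl hj), hv⟩
      · exact ⟨i.succ, le_rfl, hv⟩
  · funext x y
    rw [Subgraph.sup_adj, Walk.adj_toSubgraph_iff_mem_edges, hp.mem_edges_iff hG,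
      O.rightFace_dart]
    refine propext ⟨?_, ?_⟩
    · rintro ⟨j, hj, hv⟩
      rcases (hle j).1 hj with h | rfl
      · exact Or.inl ⟨j, h, hv⟩
      · by_cases he : s(x, y) = (O.dart i).edge
        · refine Or.inl ⟨O.prev i, O.prev_le i, ?_⟩
          change s(x, y) ∈ E.faceEdges _
          rw [he, E.mem_faceEdges_iff, O.leftFace_dart]
          exact Or.inr rfl
        · exact Or.inr ⟨hv, he⟩
    · rintro (⟨j, hj, hv⟩ | ⟨hv, -⟩)
      · exact ⟨j, (hle j).2 (Or.inl hj), hv⟩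
      · exact ⟨i.succ, le_rfl, hv⟩

theorem unionUpTo_zero : E.unionUpTo O.face 0 = E.periphery (O.face 0).1 := by
  refine Subgraph.ext ?_ ?_
  · ext v
    exact ⟨fun ⟨j, hj, hv⟩ => Fin.le_zero_iff.1 hj ▸ hv, fun hv => ⟨0, le_rfl, hv⟩⟩
  · funext x y
    exact propext ⟨fun ⟨j, hj, hv⟩ => Fin.le_zero_iff.1 hj ▸ hv, fun hv => ⟨0, le_rfl, hv⟩⟩

/-- A gluing order gives a reducible face decomposition whose ears run clockwise. -/
theorem exists_decomposition [Finite V] (hG : G.IsTwoConnected) (hE : E.IsOuterplane)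
    (c : G.Coloring Bool) :
    ∃ D : E.ReducibleFaceDecomposition m, D.face = O.face ∧
      ∀ i, E.RunsClockwise (D.sub i.succ) (D.ear i) := by
  choose p hp using fun i => E.exists_face_path hG (O.dart i)
  obtain ⟨d₀, hd₀⟩ := E.exists_rightFace (O.face 0).1
  obtain ⟨p₀, hp₀⟩ := E.exists_face_path hG d₀
  have hear : ∀ i, ∀ a ∈ (p i).darts, E.rightFace a = (O.face i.succ).1 ∧ a ≠ O.dart i :=
    fun i a ha => O.rightFace_dart i ▸ ((hp i).2 a).1 ha
  have hprev : ∀ i, (O.dart i).edge ∈ E.faceEdges (O.face (O.prev i)).1 := fun i =>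
    E.mem_faceEdges_iff.2 (Or.inr (O.leftFace_dart i))
  have hq : ∀ i e, e ∈ (O.dart i).adj.symm.toWalk.edges ↔ e = (O.dart i).edge := fun i e => by
    rw [← Dart.edge_symm]
    exact List.mem_singleton
  refine ⟨{
    card_innerFace := by
      rw [← Nat.card_eq_of_bijective _ O.bijective, Nat.card_fin]
    sub := E.unionUpTo O.face
    face := O.face
    earStart := fun i => (O.dart i).snd
    earEnd := fun i => (O.dart i).fst
    ear := p
    sub_zero := O.unionUpTo_zero
    sub_zero_eq := ⟨d₀.snd, d₀.fst, d₀.symm.adj, p₀, hp₀.1, odd_length_of_reverses c p₀, fun h => ?_,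
      ?_⟩
    ear_isPath := fun i => (hp i).1
    ear_odd := fun i => odd_length_of_reverses c (p i)
    earStart_mem := fun i => ⟨_, O.prev_le i, _, hprev i, Sym2.mem_mk_right _ _⟩
    earEnd_mem := fun i => ⟨_, O.prev_le i, _, hprev i, Sym2.mem_mk_left _ _⟩
    ear_internal := fun i v hv hv' => O.mem_gluing_edge hG hE
      (by rwa [← O.rightFace_dart, ← IsFacePath.mem_support_iff (hp i)]) hv'
    ear_exterior := fun i a ha => ⟨O.edge_notMem hE (hear i a ha).1 (hear i a ha).2,
      (hear i a ha).1 ▸ O.mem_exterior hG hE Fin.castSucc_lt_succ⟩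
    ear_surrounds := fun i => ⟨(O.dart i).adj.symm.toWalk, ?_, ?_, ?_⟩
    sub_succ := fun i => O.unionUpTo_succ hG i (hp i)
    sub_last := O.unionUpTo_last hG hE }, rfl, ?_⟩
  · rw [IsFacePath.mem_edges_iff hG hp₀] at h
    exact h.2 d₀.edge_symm
  · rw [O.unionUpTo_zero, ← hd₀]
    exact periphery_eq_sup hG hp₀
  · exact Walk.IsPath.of_adj _
  · intro e he
    obtain rfl := (hq i e).1 he
    refine ⟨mem_unionUpTo_edgeSet.2 ⟨_, O.prev_le i, hprev i⟩, O.dart i, rfl, ?_⟩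
    rw [O.rightFace_dart]
    exact O.mem_exterior hG hE Fin.castSucc_lt_succ
  · ext e
    have h1 := IsFacePath.mem_edges_iff hG (hp i) (e := e)
    rw [O.rightFace_dart] at h1
    refine Iff.trans ?_ (or_congr h1 (hq i e)).symm
    refine ⟨fun h => or_iff_not_imp_right.2 fun h3 => ⟨h, h3⟩, ?_⟩
    rintro (h | rfl)
    · exact h.1
    · exact E.mem_faceEdges_iff.2 (Or.inl (O.rightFace_dart i))
  · intro i a ha
    obtain ⟨hR, hne⟩ := hear i a ha
    refine ⟨mem_unionUpTo_edgeSet.2 ⟨i.succ, le_rfl, E.mem_faceEdges_iff.2 (Or.inl hR)⟩, ?_⟩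
    by_cases hout : E.rightFace a.symm = E.outerFace
    · rw [hout]
      exact outerFace_mem_exterior _
    · obtain ⟨l, hl⟩ := O.exists_face hout
      rw [← hl]
      refine O.mem_exterior hG hE (lt_of_le_of_ne (not_lt.1 fun h => hne ?_) fun h => ?_)
      · exact O.eq_dart hE (Fin.le_castSucc_iff.2 h) hR hl.symm
      · exact E.rightFace_symm_ne hG a (by rw [← hl, hR, h])

end GluingOrder

end PlaneEmbedding

/-! ### Gluing orders and isomorphic resonance graphs -/

/-- The elements of a connected graph can be listed one after the other, as many as one likes, so
that each one is adjacent to an earlier one. -/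
theorem SimpleGraph.exists_growing_sequence {α : Type*} [Finite α] {T : SimpleGraph α}
    (hT : ArrowConnected T.Adj) [Nonempty α] (k : ℕ) (hk : k < Nat.card α) :
    ∃ s : Fin (k + 1) → α, Function.Injective s ∧
      ∀ i : Fin k, ∃ j ≤ i.castSucc, T.Adj (s i.succ) (s j) := by
  classical
  have := Fintype.ofFinite α
  induction k with
  | zero =>
    exact ⟨fun _ => Classical.arbitrary α, fun a b _ => Fin.ext (by omega), fun i => i.elim0⟩
  | succ k ih =>
    obtain ⟨s, hs, hadj⟩ := ih (by omega)
    obtain ⟨a, ha⟩ : ∃ a, a ∉ Set.range s := by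
      by_contra! h
      have h1 := Nat.card_le_card_of_surjective s h
      rw [Nat.card_fin] at h1
      omega
    obtain ⟨f, g, hfg, hf, l, rfl⟩ : ∃ f g, T.Adj f g ∧ f ∉ Set.range s ∧ g ∈ Set.range s := by
      by_contra! h
      refine ha ((hT (· ∈ Set.range s) (fun f g hfg => ?_) (s 0) a).1 ⟨0, rfl⟩)
      by_cases h1 : f ∈ Set.range s
      · refine iff_of_true h1 (by_contra fun h2 => h g f hfg.symm h2 h1)
      · exact iff_of_false h1 (h f g hfg h1)
    refine ⟨Fin.snoc s f, ?_, fun i => ?_⟩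
    · rw [Fin.snoc_injective_iff]
      exact ⟨hs, hf⟩
    · cases i using Fin.lastCases with
      | last =>
        refine ⟨l.castSucc, Fin.castSucc_le_castSucc_iff.2 (Fin.le_last l), ?_⟩
        rw [Fin.succ_last, Fin.snoc_last, Fin.snoc_castSucc]
        exact hfg
      | cast i =>
        obtain ⟨j, hj, h⟩ := hadj i
        refine ⟨j.castSucc, Fin.castSucc_le_castSucc_iff.2 hj, ?_⟩
        rw [Fin.succ_castSucc, Fin.snoc_castSucc, Fin.snoc_castSucc]
        exact h

namespace PlaneEmbedding

section

variable {V : Type u} {G : SimpleGraph V} {E : PlaneEmbedding G}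

theorem exists_gluingOrder {m : ℕ} {s : Fin (m + 1) → E.InnerFace} (hs : Function.Bijective s)
    (hadj : ∀ i : Fin m, ∃ j ≤ i.castSucc, E.innerDual.Adj (s i.succ) (s j)) :
    ∃ O : E.GluingOrder m, O.face = s := by
  choose j hj hadj using hadj
  choose d hR hL using fun i => (E.innerDual_adj_iff.1 (hadj i)).2
  exact ⟨⟨s, hs, j, hj, d, hR, hL⟩, rfl⟩

theorem exists_face_enumeration [Finite V] (hG : G.IsTwoConnected) (hE : E.IsOuterplane)
    (c : G.Coloring Bool) : ∃ (m : ℕ) (s : Fin (m + 1) → E.InnerFace), Function.Bijective s ∧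
      ∀ i : Fin m, ∃ j ≤ i.castSucc, E.innerDual.Adj (s i.succ) (s j) := by
  classical
  have : Nonempty E.InnerFace := by
    obtain ⟨d, hd⟩ := E.exists_rightFace E.outerFace
    exact ⟨⟨E.rightFace d.symm, hd ▸ E.rightFace_symm_ne hG d⟩⟩
  have hpos := Nat.card_pos (α := E.InnerFace)
  obtain ⟨s, hs, hadj⟩ := exists_growing_sequence (T := E.innerDual) (fun P hP =>
    E.arrowConnected_precedes hG hE c P fun f g hfg =>
      hP f g ((E.precedes_or_precedes_iff hG c).1 (Or.inl hfg))) (Nat.card E.InnerFace - 1)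
      (by omega)
  have := Fintype.ofFinite E.InnerFace
  refine ⟨_, s, (Fintype.bijective_iff_injective_and_card s).2 ⟨hs, ?_⟩, hadj⟩
  rw [Fintype.card_fin, ← Nat.card_eq_fintype_card]
  omega

end

variable {V V' : Type*} [Finite V] [Finite V'] {G : SimpleGraph V} {G' : SimpleGraph V'}
  {E : PlaneEmbedding G} {E' : PlaneEmbedding G'}

/-- The resonance graphs are isomorphic if and only if the oriented inner duals are, for a suitable
choice of colours. -/
theorem resonanceGraph_iso_iff (hG : G.IsTwoConnected) (hE : E.IsOuterplane)
    (hG' : G'.IsTwoConnected) (hE' : E'.IsOuterplane) (c : G.Coloring Bool)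
    (c₀ : G'.Coloring Bool) :
    Nonempty (E.resonanceGraph ≃g E'.resonanceGraph) ↔
      ∃ (c' : G'.Coloring Bool) (L : E.InnerFace ≃ E'.InnerFace),
        ∀ f g, E.precedes c f g ↔ E'.precedes c' (L f) (L g) := by
  obtain ⟨ψ⟩ := E.nonempty_idealGraph_iso hG hE c
  constructor
  · rintro ⟨φ⟩
    obtain ⟨ψ'⟩ := E'.nonempty_idealGraph_iso hG' hE' c₀
    obtain ⟨L, hL | hL⟩ := exists_equiv_of_idealGraph_iso (E.arrowsAreCuts_precedes hE c)
      (E'.arrowsAreCuts_precedes hE' c₀) (E.arrowConnected_precedes hG hE c)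
      ((ψ.trans φ).trans ψ'.symm)
    · exact ⟨c₀, L, hL⟩
    · refine ⟨Coloring.mk (fun v => !c₀ v) fun {v w} h h' => c₀.valid h (Bool.not_inj h'), L,
        fun f g => ?_⟩
      exact (hL f g).trans (E'.precedes_swap (fun _ => rfl) _ _).symm
  · rintro ⟨c', L, hL⟩
    obtain ⟨ψ'⟩ := E'.nonempty_idealGraph_iso hG' hE' c'
    obtain ⟨φ⟩ := nonempty_idealGraph_iso_of_equiv L hL
    exact ⟨(ψ.symm.trans φ).trans ψ'⟩

/-- Decompositions along corresponding enumerations of the faces have ears with matching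
colours. -/
theorem color_ear_eq (hG : G.IsTwoConnected) (hE : E.IsOuterplane)
    (hG' : G'.IsTwoConnected) (hE' : E'.IsOuterplane) {c : G.Coloring Bool}
    {c' : G'.Coloring Bool} {L : E.InnerFace → E'.InnerFace}
    (hL : ∀ f g, E.precedes c f g → E'.precedes c' (L f) (L g)) {m : ℕ}
    {D : E.ReducibleFaceDecomposition m} {D' : E'.ReducibleFaceDecomposition m}
    (hLD : ∀ i, L (D.face i) = D'.face i)
    (hD : ∀ i, E.RunsClockwise (D.sub i.succ) (D.ear i))
    (hD' : ∀ i, E'.RunsClockwise (D'.sub i.succ) (D'.ear i)) (i : Fin m) :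
    c (D.earStart i) = c' (D'.earStart i) ∧ c (D.earEnd i) = c' (D'.earEnd i) := by
  obtain ⟨j, hj, hadj⟩ := D.exists_adj_earlier i
  obtain ⟨-, d, hR, hL'⟩ := E.innerDual_adj_iff.1 hadj
  have h1 := D.dart_eq_of_clockwise hG hE (hD i) hj hR hL'
  obtain ⟨d', hd', hR', hL''⟩ : ∃ d' : G'.Dart, c' d'.fst = c d.fst ∧
      E'.rightFace d' = (D'.face i.succ).1 ∧ E'.rightFace d'.symm = (D'.face j).1 := by
    rw [← hLD, ← hLD]
    cases hd : c d.fst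
    · obtain ⟨d', hd', hR', hL''⟩ := hL (D.face j) (D.face i.succ)
        ⟨d.symm, by change c d.snd = true; rw [coloring_snd, hd]; rfl, hL', by rwa [Dart.symm_symm]⟩
      refine ⟨d'.symm, ?_, hL'', by rwa [Dart.symm_symm]⟩
      change c' d'.snd = false
      rw [coloring_snd, hd']
      rfl
    · obtain ⟨d', hd', h⟩ := hL (D.face i.succ) (D.face j) ⟨d, hd, hR, hL'⟩
      exact ⟨d', hd', h⟩
  have h2 := D'.dart_eq_of_clockwise hG' hE' (hD' i) hj hR' hL''
  rw [← h1.1, ← h1.2, ← h2.1, ← h2.2, coloring_snd, coloring_snd, hd']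
  exact ⟨rfl, rfl⟩

end PlaneEmbedding

theorem theorem3p3 {V V' : Type*} [Finite V] [Finite V']
    {G : SimpleGraph V} {G' : SimpleGraph V'}
    (E : PlaneEmbedding G) (E' : PlaneEmbedding G')
    (hconn : G.IsTwoConnected) (hbip : G.IsBipartite) (hout : E.IsOuterplane)
    (hconn' : G'.IsTwoConnected) (hbip' : G'.IsBipartite) (hout' : E'.IsOuterplane) :
    Nonempty (E.resonanceGraph ≃g E'.resonanceGraph) ↔
      ∃ (m : ℕ) (D : E.ReducibleFaceDecomposition m) (D' : E'.ReducibleFaceDecomposition m),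
        (∃ α : E.innerDual ≃g E'.innerDual, ∀ i, α (D.face i) = D'.face i) ∧
        (∀ i, E.RunsClockwise (D.sub i.succ) (D.ear i)) ∧
        (∀ i, E'.RunsClockwise (D'.sub i.succ) (D'.ear i)) ∧
        ∃ (c : G.Coloring Bool) (c' : G'.Coloring Bool),
          ∀ i, c (D.earStart i) = c' (D'.earStart i) ∧ c (D.earEnd i) = c' (D'.earEnd i) := by
  obtain ⟨b⟩ := hbip
  obtain ⟨b'⟩ := hbip'
  have c₁ : G.Coloring Bool := G.recolorOfEquiv finTwoEquiv b
  have c₁' : G'.Coloring Bool := G'.recolorOfEquiv finTwoEquiv b'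
  constructor
  · intro h
    obtain ⟨c', L, hL⟩ :=
      (PlaneEmbedding.resonanceGraph_iso_iff hconn hout hconn' hout' c₁ c₁').1 h
    let α : E.innerDual ≃g E'.innerDual := ⟨L, fun {f g} => by
      rw [← E.precedes_or_precedes_iff hconn c₁, ← E'.precedes_or_precedes_iff hconn' c', hL, hL]⟩
    obtain ⟨m, s, hs, hadj⟩ := PlaneEmbedding.exists_face_enumeration hconn hout c₁
    obtain ⟨O, hO⟩ := PlaneEmbedding.exists_gluingOrder hs hadj
    obtain ⟨O', hO'⟩ := PlaneEmbedding.exists_gluingOrder (s := fun i => α (s i))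
      (α.bijective.comp hs) fun i => by
        obtain ⟨j, hj, h⟩ := hadj i
        exact ⟨j, hj, α.map_rel_iff.2 h⟩
    obtain ⟨D, hDf, hD⟩ := O.exists_decomposition hconn hout c₁
    obtain ⟨D', hDf', hD'⟩ := O'.exists_decomposition hconn' hout' c'
    have hα : ∀ i, α (D.face i) = D'.face i := fun i => by rw [hDf, hDf', hO, hO']
    exact ⟨m, D, D', ⟨α, hα⟩, hD, hD', c₁, c', PlaneEmbedding.color_ear_eq hconn hout hconn' hout'
      (fun f g => (hL f g).1) hα hD hD'⟩
  · rintro ⟨m, D, D', ⟨α, hα⟩, hD, hD', c, c', hc⟩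
    refine (PlaneEmbedding.resonanceGraph_iso_iff hconn hout hconn' hout' c c').2
      ⟨c', α.toEquiv, fun f g => ⟨PlaneEmbedding.precedes_of_decompositions hconn hout hconn' hout'
        D D' α hα hD hD' hc, fun h => ?_⟩⟩
    have h1 := PlaneEmbedding.precedes_of_decompositions hconn' hout' hconn hout D' D α.symm
      (fun i => by rw [← hα, α.symm_apply_apply]) hD' hD
      (fun i => ⟨(hc i).1.symm, (hc i).2.symm⟩) h
    have h2 : ∀ f, α.symm (α.toEquiv f) = f := α.symm_apply_apply
    rwa [h2, h2] at h1
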